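/- **Setting.** Let $n\ge 1$ and let $q$ be a variable. A *noncrossing matching* of size $n$ is a partition of the points $1,\dots,2n$ on a line into $n$ pairs, drawn as pairwise noncrossing arches above the line; $\mathrm{NC}_n$ is the set of these, and $()_n$ is the matching of $n$ nested arches. The Young diagram $\lambda(\pi)$ of $\pi\in\mathrm{NC}_n$ is the region between the lattice path of $n$ north-steps followed by $n$ east-steps and the path whose $i$-th step is north if $i$ is a left-endpoint of an arch of $\pi$ and east otherwise. Write $\sigma\le\pi$ if $\lambda(\sigma)\subseteq\lambda(\pi)$. The box in row $r$ and column $c$ (both counted from $1$, from the top and from the left) lies on the diagonal $n+c-r$; write $\sigma\nearrow_j\pi$, for $2\le j\le 2n-2$, if $\lambda(\pi)$ arises from $\lambda(\sigma)$ by adding one box on the diagonal $j$. The Temperley–Lieb operator $e_j:\mathrm{NC}_n\to\mathrm{NC}_n$ deletes the arches at the points $j$ and $j+1$, and adds an arch between $j$ and $j+1$ and an arch between their former partners (if $j$ and $j+1$ are already joined, nothing changes). A *wheel polynomial* of order $n$ is a homogeneous polynomial $p\in\mathbb{Q}(q)[z_1,\dots,z_{2n}]$ of degree $n(n-1)$ with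 $p|_{q^4z_i=q^2z_j=z_k}=0$ for all $1\le i<j<k\le 2n$; these form the $\mathbb{Q}(q)$-vector space $W_n[z]$. For $1\le k\le 2n-1$ let $$\mathbf{D}_k(f)=\frac{qz_k-q^{-1}z_{k+1}}{z_{k+1}-z_k}\bigl(f(\dots,z_{k+1},z_k,\dots)-f\bigr).$$ Put $$\Psi_{()_n}=(q-q^{-1})^{-n(n-1)}\prod_{1\le i<j\le n}(qz_i-q^{-1}z_j)(qz_{n+i}-q^{-1}z_{n+j}),$$ and for $\pi\ne()_n$ define recursively, using any $\sigma$ and $j$ with $\sigma\nearrow_j\pi$, $$\Psi_\pi=\mathbf{D}_j(\Psi_\sigma)-\sum_{\tau\in e_j^{-1}(\sigma)\setminus\{\sigma,\pi\}}\Psi_\tau .$$ For $\pi\in\mathrm{NC}_n$ with $\lambda(\pi)=(\lambda_1,\dots,\lambda_l)$, let $D_\pi$ be the polynomial obtained from $\Psi_{()_n}$ by reading the boxes of $\lambda(\pi)$ row by row from top to bottom, each row from left to right, and applying $\mathbf{D}_k$ for each box, where $k$ is the diagonal of the box; that is, $$D_\pi=\Bigl(\prod_{i=1}^{l}\prod_{j=1}^{\lambda_{l+1-i}}\mathbf{D}_{n+(i-l)+(\lambda_{l+1-i}-j)}\Bigr)(\Psi_{()_n}),$$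 where the products denote compositions, written from left to right. **Theorem.** The family $(D_\pi)_{\pi\in\mathrm{NC}_n}$ is a $\mathbb{Q}(q)$-basis of $W_n[z]$. Moreover, whichever arrows $\sigma\nearrow_j\pi$ are used in the recursion for the $\Psi_\pi$, each $\Psi_\pi$ with $\pi\in\mathrm{NC}_n$ is a $\mathbb{Q}(q)$-linear combination of the $D_\tau$ with $\tau\le\pi$, in which the coefficient of $D_\pi$ is $1$. -/

import Mathlib

namespace WheelPoly

/-! ### Noncrossing matchings -/

/-- A noncrossing matching of size `n`: `2n` points on a line, numbered here by `Fin (2 * n)`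
(the point with label `k ∈ {1, …, 2n}` is the element `k - 1`), each point joined to exactly one
other point `partner i`, such that no two arches cross. -/
@[ext]
structure NCMatching (n : ℕ) where
  partner : Fin (2 * n) → Fin (2 * n)
  partner_partner : ∀ i, partner (partner i) = i
  partner_ne : ∀ i, partner i ≠ i
  noncrossing : ∀ a b, ¬ (a < b ∧ b < partner a ∧ partner a < partner b)

namespace NCMatching

variable {n : ℕ}

noncomputable instance : DecidableEq (NCMatching n) := Classical.decEq _

noncomputable instance : Fintype (NCMatching n) :=
  Fintype.ofInjective NCMatching.partner (fun _ _ h => NCMatching.ext h)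

/-- The matching `()_n` consisting of `n` nested arches. -/
def nested (n : ℕ) : NCMatching n where
  partner := Fin.rev
  partner_partner := Fin.rev_rev
  partner_ne := fun i h => by
    have := congrArg Fin.val h
    rw [Fin.val_rev] at this
    omega
  noncrossing := fun a b h => by
    simp only [Fin.lt_def, Fin.val_rev] at h
    omega

/-- The number of points to the left of `i` that are left-endpoints of an arch
(the height of the lattice path of `π` before its step number `i`). -/
def height (π : NCMatching n) (i : Fin (2 * n)) : ℕ :=
  (Finset.univ.filter (fun k => k < i ∧ k < π.partner k)).card

/-- The length of the row number `r` (counted from the top, starting with `0`) of the Young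
diagram of `π`. That row lies between the heights `n - r - 1` and `n - r`, and its length is the
number of east-steps (right-endpoints of arches) that the lattice path of `π` makes before it
reaches the height `n - r`. -/
def rowLen (π : NCMatching n) (r : ℕ) : ℕ :=
  (Finset.univ.filter (fun i => π.partner i < i ∧ π.height i < n - r)).card

lemma rowLen_anti (π : NCMatching n) {r s : ℕ} (h : r ≤ s) : π.rowLen s ≤ π.rowLen r := by
  apply Finset.card_le_card
  intro i hi
  simp only [Finset.mem_filter, Finset.mem_univ, true_and] at hi ⊢
  exact ⟨hi.1, by omega⟩

/-- The Young diagram `λ(π)`; the cell `(r, c)` is the box in row `r` and column `c`, both counted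
from `0`. -/
def young (π : NCMatching n) : YoungDiagram where
  cells := (Finset.range n ×ˢ Finset.range (π.rowLen 0)).filter (fun x => x.2 < π.rowLen x.1)
  isLowerSet := by
    rintro ⟨r, c⟩ ⟨r', c'⟩ hle hmem
    obtain ⟨h1, h2⟩ := Prod.mk_le_mk.1 hle
    simp only [Finset.coe_filter, Finset.mem_product, Finset.mem_range, Set.mem_ofPred_eq] at hmem ⊢
    have := π.rowLen_anti h1
    have := π.rowLen_anti (Nat.zero_le r')
    omega

/-- `σ ≤ π` iff the Young diagram of `σ` is contained in the Young diagram of `π`. -/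
instance : LE (NCMatching n) := ⟨fun σ π => σ.young ≤ π.young⟩

end NCMatching

/-- The number of the diagonal on which the box `(r, c)` lies (row `r` and column `c` counted from
`0`): the top left box lies on the diagonal `n`, the number increases by one for each step to the
right and decreases by one for each step down. -/
def diagonal (n : ℕ) (x : ℕ × ℕ) : ℕ := n + x.2 - x.1

/-- `σ ↗_j π`: the diagram `λ(π)` is obtained from `λ(σ)` by adding a box on the diagonal `j`. -/
def Arrow {n : ℕ} (j : ℕ) (σ π : NCMatching n) : Prop :=
  2 ≤ j ∧ j ≤ 2 * n - 2 ∧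
    ∃ x, x ∉ σ.young.cells ∧ π.young.cells = insert x σ.young.cells ∧ diagonal n x = j

/-- The point with label `k`; the labels are read modulo `2n`. -/
def pt (n : ℕ) [NeZero n] (k : ℕ) : Fin (2 * n) :=
  ⟨(k + (2 * n - 1)) % (2 * n), Nat.mod_lt _ (by have := NeZero.pos n; omega)⟩

lemma pt_adjacent (n : ℕ) [NeZero n] (j : ℕ) :
    pt n j ≠ pt n (j + 1) ∧
      ((∀ a, a ≠ pt n j → a ≠ pt n (j + 1) → (a < pt n j ↔ a < pt n (j + 1))) ∨
        ∀ a, a ≠ pt n j → a ≠ pt n (j + 1) → a < pt n j ∧ pt n (j + 1) < a) := by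
  have hn := NeZero.pos n
  obtain ⟨m, hm⟩ : ∃ m, (j + (2 * n - 1)) % (2 * n) = m := ⟨_, rfl⟩
  have hlt : m < 2 * n := hm ▸ Nat.mod_lt _ (by omega)
  have h2 : (j + 1 + (2 * n - 1)) % (2 * n) = if m + 1 = 2 * n then 0 else m + 1 := by
    rw [show j + 1 + (2 * n - 1) = (j + (2 * n - 1)) + 1 by omega, Nat.add_mod, hm,
      Nat.mod_eq_of_lt (a := 1) (by omega)]
    split_ifs with h
    · rw [h, Nat.mod_self]
    · exact Nat.mod_eq_of_lt (by omega)
  simp only [pt, Fin.lt_def, ne_eq, Fin.ext_iff, hm, h2]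
  refine ⟨?_, ?_⟩
  · split_ifs <;> omega
  · by_cases h : m + 1 = 2 * n
    · simp only [if_pos h]
      exact Or.inr (fun a ha hb => by have := a.2; omega)
    · simp only [if_neg h]
      exact Or.inl (fun a ha hb => by omega)

lemma surgery_involutive {N : ℕ} (f : Fin N → Fin N) (hf : ∀ i, f (f i) = i)
    (hne : ∀ i, f i ≠ i) (p r : Fin N) (hpr : p ≠ r) (g : Fin N → Fin N)
    (hg : ∀ k, g k = if k = p then r else if k = r then p else if k = f p then f r
      else if k = f r then f p else f k) (k : Fin N) : g (g k) = k ∧ g k ≠ k := by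
  have h1 := hg k
  have h2 := hg (g k)
  have := hf k
  have := hf p
  have := hf r
  have := hne p
  have := hne r
  have := hne k
  clear hg
  grind

lemma surgery_noncrossing {N : ℕ} (f : Fin N → Fin N) (hf : ∀ i, f (f i) = i)
    (hne : ∀ i, f i ≠ i)
    (hc : ∀ a b, ¬ (a < b ∧ b < f a ∧ f a < f b)) (p r : Fin N) (hpr : p ≠ r)
    (hadj : (∀ a, a ≠ p → a ≠ r → (a < p ↔ a < r)) ∨ ∀ a, a ≠ p → a ≠ r → a < p ∧ r < a) (g : Fin N → Fin N)
    (hg : ∀ k, g k = if k = p then r else if k = r then p else if k = f p then f r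
      else if k = f r then f p else f k) :
    ∀ a b, ¬ (a < b ∧ b < g a ∧ g a < g b) := by
  have K : ∀ a b, a < b → b < f a → a < f b ∧ f b < f a := by
    intro a b h1 h2
    have h3 := hc a b
    have h4 := hc (f b) a
    rw [hf] at h4
    have h5 : f b ≠ f a := fun h => h1.ne' (by rw [← hf a, ← h, hf])
    have h6 : f b ≠ a := fun h => h2.ne (by rw [← h, hf])
    grind
  have hgg := fun k => (surgery_involutive f hf hne p r hpr g hg k).1
  have hgp : g p = r := by grind
  have hgr : g r = p := by grind
  rintro a b ⟨h1, h2, h3⟩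
  have gga := hgg a
  have ggb := hgg b
  have fp := hf p
  have fr := hf r
  have ga := hg a
  have gb := hg b
  have k1 := K b (f r)
  have k2 := K b p
  have k3 := K b (f p)
  have k4 := K b r
  have k5 := K a (f p)
  have k6 := K a (f r)
  have k7 := K a r
  have k8 := K a p
  have k9 := hc a b
  have k10 := K r b
  have k11 := K p b
  have k12 := K r a
  rcases hadj with hadj | hadj
  all_goals
    have A1 := hadj a
    have A2 := hadj (g a)
    have B1 := hadj b
    have B2 := hadj (g b)
    clear hg hgg hadj hc K hf hne
    by_cases hap : a = p
    · grind
    by_cases har : a = r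
    · grind
    by_cases hbp : b = p
    · grind
    by_cases hbr : b = r
    · grind
    have hga : g a ≠ p := by grind
    have hga' : g a ≠ r := by grind
    have hgb : g b ≠ p := by grind
    have hgb' : g b ≠ r := by grind
    replace A1 := A1 hap har
    replace A2 := A2 hga hga'
    replace B1 := B1 hbp hbr
    replace B2 := B2 hgb hgb'
    rw [if_neg hap, if_neg har] at ga
    rw [if_neg hbp, if_neg hbr] at gb
    by_cases c1 : a = f p
    · rw [if_pos c1] at ga
      grind
    by_cases c2 : a = f r
    · rw [if_neg c1, if_pos c2] at ga
      grind
    rw [if_neg c1, if_neg c2] at ga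
    grind

section
variable {n : ℕ}

/-- The Temperley-Lieb operator `e_j`: delete the arches of `π` at the points `j` and `j + 1`, and
add an arch between `j` and `j + 1` and an arch between their former partners. -/
def tl [NeZero n] (j : ℕ) (π : NCMatching n) : NCMatching n where
  partner k :=
    if k = pt n j then pt n (j + 1)
    else if k = pt n (j + 1) then pt n j
    else if k = π.partner (pt n j) then π.partner (pt n (j + 1))
    else if k = π.partner (pt n (j + 1)) then π.partner (pt n j)
    else π.partner k
  partner_partner k := (surgery_involutive π.partner π.partner_partner π.partner_ne (pt n j)
    (pt n (j + 1)) (pt_adjacent n j).1 _ (fun _ => rfl) k).1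
  partner_ne k := (surgery_involutive π.partner π.partner_partner π.partner_ne (pt n j)
    (pt n (j + 1)) (pt_adjacent n j).1 _ (fun _ => rfl) k).2
  noncrossing := surgery_noncrossing π.partner π.partner_partner π.partner_ne π.noncrossing (pt n j)
    (pt n (j + 1)) (pt_adjacent n j).1 (pt_adjacent n j).2 _ (fun _ => rfl)

end

section

/-! ### Facts needed for the termination of the recursion below -/

namespace NCMatching
variable {n : ℕ}

lemma right_iff (π : NCMatching n) (i : Fin (2 * n)) : π.partner i < i ↔ ¬ i < π.partner i := by
  have := π.partner_ne i
  grind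

lemma card_left (π : NCMatching n) :
    (Finset.univ.filter (fun k => k < π.partner k)).card = n := by
  have h1 : (Finset.univ.filter (fun k => k < π.partner k)).card =
      (Finset.univ.filter (fun k => ¬ k < π.partner k)).card := by
    refine Finset.card_bij' (fun k _ => π.partner k) (fun k _ => π.partner k) ?_ ?_ ?_ ?_ <;>
      intro k hk <;>
      simp only [Finset.mem_filter, Finset.mem_univ, true_and, π.partner_partner] at hk ⊢
    · exact hk.le.not_gt
    · exact (π.right_iff k).2 hk
  have h2 := Finset.card_filter_add_card_filter_not (s := (Finset.univ : Finset (Fin (2 * n))))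
    (fun k => k < π.partner k)
  rw [Finset.card_univ, Fintype.card_fin] at h2
  omega

lemma height_mono (π : NCMatching n) {i k : Fin (2 * n)} (h : i ≤ k) :
    π.height i ≤ π.height k := by
  apply Finset.card_le_card
  intro x hx
  simp only [Finset.mem_filter, Finset.mem_univ, true_and] at hx ⊢
  exact ⟨hx.1.trans_le h, hx.2⟩

lemma height_lt (π : NCMatching n) {i k : Fin (2 * n)} (hi : i < π.partner i) (h : i < k) :
    π.height i < π.height k := by
  apply Finset.card_lt_card
  refine Finset.ssubset_iff.2 ⟨i, by simp, ?_⟩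
  intro x hx
  simp only [Finset.mem_insert, Finset.mem_filter, Finset.mem_univ, true_and] at hx ⊢
  rcases hx with rfl | hx
  · exact ⟨h, hi⟩
  · exact ⟨hx.1.trans h, hx.2⟩

lemma height_lt_n (π : NCMatching n) {i : Fin (2 * n)} (hi : i < π.partner i) :
    π.height i < n := by
  conv_rhs => rw [← π.card_left]
  apply Finset.card_lt_card
  refine Finset.ssubset_iff.2 ⟨i, by simp, ?_⟩
  intro x hx
  simp only [Finset.mem_insert, Finset.mem_filter, Finset.mem_univ, true_and] at hx ⊢
  rcases hx with rfl | hx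
  · exact hi
  · exact hx.2

lemma mem_young (π : NCMatching n) (r c : ℕ) : (r, c) ∈ π.young.cells ↔ c < π.rowLen r := by
  have h0 := π.rowLen_anti (Nat.zero_le r)
  have h1 : 0 < π.rowLen r → r < n := by
    intro h
    obtain ⟨i, hi⟩ := Finset.card_pos.1 h
    simp only [Finset.mem_filter] at hi
    omega
  simp only [young, Finset.mem_filter, Finset.mem_product, Finset.mem_range]
  omega

/-- The right-endpoints at height less than `m`; there are `rowLen (n - m)` of them. -/
def low (π : NCMatching n) (m : ℕ) : Finset (Fin (2 * n)) :=
  Finset.univ.filter (fun i => π.partner i < i ∧ π.height i < m)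

lemma rowLen_eq (π : NCMatching n) (r : ℕ) : π.rowLen r = (π.low (n - r)).card := rfl

lemma mem_low (π : NCMatching n) (m : ℕ) (i : Fin (2 * n)) :
    i ∈ π.low m ↔ π.partner i < i ∧ π.height i < m := by
  simp [low]

/-- A noncrossing matching is determined by its left-endpoints. -/
lemma ext_left {σ π : NCMatching n}
    (h : ∀ i, i < σ.partner i ↔ i < π.partner i) : σ = π := by
  have key : ∀ (m : ℕ) (i : Fin (2 * n)), 2 * n - i.val = m → i < σ.partner i →
      σ.partner i = π.partner i := by
    intro m
    induction m using Nat.strong_induction_on with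
    | _ m ih =>
      intro i hm hi
      have aux : ∀ (σ π : NCMatching n), (∀ i, i < σ.partner i ↔ i < π.partner i) →
          (∀ k, i < k → k < σ.partner k → σ.partner k = π.partner k) → i < σ.partner i →
          ¬ σ.partner i < π.partner i := by
        intro σ π h ih hi hlt
        have h1 := h (σ.partner i)
        have h2 := π.partner_partner (σ.partner i)
        have h3 := π.partner_ne (σ.partner i)
        have h4 := σ.partner_partner i
        have h5 := ih (π.partner (σ.partner i))
        have h6 := π.noncrossing (π.partner (σ.partner i)) i
        have h7 := h (π.partner (σ.partner i))
        have h8 := σ.partner_partner (π.partner (σ.partner i))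
        have h9 := π.partner_partner i
        grind
      have a1 := aux σ π h (fun k hk hk' => ih _ (by have := k.2; omega) k rfl hk') hi
      have a2 := aux π σ (fun i => (h i).symm)
        (fun k hk hk' => (ih _ (by have := k.2; omega) k rfl ((h k).2 hk')).symm) ((h i).1 hi)
      exact le_antisymm (not_lt.1 a2) (not_lt.1 a1)
  ext1
  funext i
  by_cases hi : i < σ.partner i
  · exact key _ i rfl hi
  · have h1 := (σ.right_iff i).2 hi
    have h2 := key _ (σ.partner i) rfl (by rw [σ.partner_partner]; exact h1)
    rw [σ.partner_partner] at h2
    have h3 := π.partner_partner (σ.partner i)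
    rw [← h2] at h3
    exact h3.symm

/-- A noncrossing matching is determined by its Young diagram. -/
lemma young_injective {σ π : NCMatching n} (h : σ.young = π.young) : σ = π := by
  have hr : ∀ r, σ.rowLen r = π.rowLen r := by
    intro r
    apply le_antisymm <;> by_contra hc
    · have := (σ.mem_young r (π.rowLen r)).2 (by omega)
      rw [h, mem_young] at this
      omega
    · have := (π.mem_young r (σ.rowLen r)).2 (by omega)
      rw [← h, mem_young] at this
      omega
  have aux : ∀ (σ π : NCMatching n), (∀ r, σ.rowLen r = π.rowLen r) → ∀ i : Fin (2 * n),
      (∀ k, k < i → (k < σ.partner k ↔ k < π.partner k)) → i < σ.partner i → i < π.partner i := by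
    intro σ π hr i ih hi
    by_contra hc
    have hh : ∀ k, k ≤ i → σ.height k = π.height k := by
      intro k hk
      unfold height
      congr 1
      ext x
      simp only [Finset.mem_filter, Finset.mem_univ, true_and, and_congr_right_iff]
      exact fun hx => ih x (hx.trans_le hk)
    have hlt := σ.height_lt_n hi
    have h1 := hr (n - (σ.height i + 1))
    rw [rowLen_eq, rowLen_eq, show n - (n - (σ.height i + 1)) = σ.height i + 1 by omega] at h1
    refine absurd h1 (ne_of_lt (Finset.card_lt_card (Finset.ssubset_iff.2 ⟨i, ?_, ?_⟩)))
    · rw [mem_low]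
      exact fun h => absurd h.1 (not_lt.2 hi.le)
    · intro x hx
      rw [Finset.mem_insert, mem_low] at hx
      rw [mem_low]
      rcases hx with rfl | hx
      · exact ⟨(π.right_iff x).2 hc, by rw [← hh x le_rfl]; omega⟩
      · have hxi : x < i := by
          by_contra hxi
          rcases eq_or_lt_of_le (not_lt.1 hxi) with rfl | h'
          · exact absurd hx.1 (not_lt.2 hi.le)
          · have := σ.height_lt hi h'
            omega
        refine ⟨(π.right_iff x).2 (fun h' => ?_), by rw [← hh x hxi.le]; exact hx.2⟩
        exact absurd hx.1 (not_lt.2 ((ih x hxi).2 h').le)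
  apply ext_left
  intro i
  have : ∀ (m : ℕ) (i : Fin (2 * n)), i.val = m → (i < σ.partner i ↔ i < π.partner i) := by
    intro m
    induction m using Nat.strong_induction_on with
    | _ m ih =>
      intro i hi
      have ih' : ∀ k, k < i → (k < σ.partner k ↔ k < π.partner k) := fun k hk =>
        ih k.val (by omega) k rfl
      exact ⟨aux σ π hr i ih', aux π σ (fun r => (hr r).symm) i (fun k hk => (ih' k hk).symm)⟩
  exact this _ i rfl

/-- Moving a left-endpoint to the left shrinks the Young diagram. -/
lemma young_le_of_move {σ τ : NCMatching n} (u v : Fin (2 * n)) (huv : u < v)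
    (hu : σ.partner u < u) (hv : v < σ.partner v) (hu' : u < τ.partner u) (hv' : τ.partner v < v)
    (h : ∀ i, i ≠ u → i ≠ v → (i < σ.partner i ↔ i < τ.partner i)) : τ ≤ σ := by
  change τ.young ≤ σ.young
  have hh : ∀ i, σ.height i ≤ τ.height i := by
    intro i
    refine Finset.card_le_card_of_injOn (fun k => if k = v then u else k) ?_ ?_
    · intro k hk
      simp only [Finset.coe_filter, Finset.mem_univ, true_and, Set.mem_ofPred_eq] at hk ⊢
      have := h k
      grind
    · intro k hk l hl
      simp only [Finset.coe_filter, Finset.mem_univ, true_and, Set.mem_ofPred_eq] at hk hl ⊢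
      grind
  have h2 : ∀ r, τ.rowLen r ≤ σ.rowLen r := by
    intro r
    rw [rowLen_eq, rowLen_eq]
    refine Finset.card_le_card_of_injOn (fun k => if k = v then u else k) ?_ ?_
    · intro k hk
      simp only [Finset.mem_coe, mem_low] at hk ⊢
      have h1 := h k
      have h3 := σ.right_iff k
      have h4 := hh k
      have h5 := σ.height_mono huv.le
      have h6 := hh v
      have h7 := hh u
      by_cases hkv : k = v
      · subst hkv
        rw [if_pos rfl]
        exact ⟨hu, by omega⟩
      · rw [if_neg hkv]
        have : k ≠ u := by
          rintro rfl
          exact absurd hk.1 (not_lt.2 hu'.le)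
        refine ⟨h3.2 (fun h' => ?_), by omega⟩
        exact absurd hk.1 (not_lt.2 ((h1 this hkv).1 h').le)
    · intro k hk l hl
      simp only [Finset.mem_coe, mem_low] at hk hl ⊢
      grind
  intro x hx
  obtain ⟨r, c⟩ := x
  have h3 := (τ.mem_young r c).1 hx
  exact (σ.mem_young r c).2 (lt_of_lt_of_le h3 (h2 r))

/-- Exchanging a left-endpoint at a point with an adjacent right-endpoint adds one box. -/
lemma young_of_swap {σ τ : NCMatching n} (p r : Fin (2 * n)) (hpr : r.val = p.val + 1)
    (hp : p < σ.partner p) (hr : σ.partner r < r) (hp' : τ.partner p < p) (hr' : r < τ.partner r)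
    (h : ∀ i, i ≠ p → i ≠ r → (i < σ.partner i ↔ i < τ.partner i)) :
    Arrow r.val σ τ := by
  have hlt : p < r := by rw [Fin.lt_def]; omega
  have hadj : ∀ i, i ≠ p → i ≠ r → (p < i ↔ r < i) := by
    intro i h1 h2
    simp only [Fin.lt_def, ne_eq, Fin.ext_iff] at *
    omega
  have hh : ∀ i, i ≠ r → τ.height i = σ.height i := by
    intro i hi
    refine Finset.card_bij' (fun k _ => Equiv.swap p r k) (fun k _ => Equiv.swap p r k) ?_ ?_
      (fun _ _ => Equiv.swap_apply_self _ _ _) (fun _ _ => Equiv.swap_apply_self _ _ _)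
    all_goals
      intro k hk
      simp only [Finset.mem_filter, Finset.mem_univ, true_and] at hk ⊢
      have h1 := h k
      have h2 := hadj i
      rw [Equiv.swap_apply_def]
      grind
  have hhr : σ.height r = σ.height p + 1 := by
    have : (Finset.univ.filter (fun k => k < r ∧ k < σ.partner k)) =
        insert p (Finset.univ.filter (fun k => k < p ∧ k < σ.partner k)) := by
      ext k
      simp only [Finset.mem_filter, Finset.mem_univ, true_and, Finset.mem_insert]
      have : k ≠ p → (k < r ↔ k < p) := by
        simp only [Fin.lt_def, ne_eq, Fin.ext_iff]
        omega
      grind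
    unfold height
    rw [this, Finset.card_insert_of_notMem (by simp)]
  have hn := σ.height_lt_n hp
  have hl : ∀ m, (τ.low m).card = (σ.low m).card + if m = σ.height p + 1 then 1 else 0 := by
    intro m
    have e : (τ.low m).erase p = (σ.low m).erase r := by
      ext k
      simp only [Finset.mem_erase, mem_low]
      by_cases h1 : k = r
      · subst h1
        simp [hr'.le]
      by_cases h2 : k = p
      · subst h2
        simp [hp.le]
      rw [hh k h1, σ.right_iff, τ.right_iff, h k h2 h1]
      simp [h1, h2]
    have e1 : p ∈ τ.low m ↔ σ.height p < m := by
      rw [mem_low, hh p hlt.ne]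
      simp [hp']
    have e2 : r ∈ σ.low m ↔ σ.height p + 1 < m := by
      rw [mem_low, hhr]
      simp [hr]
    have e3 := congrArg Finset.card e
    rw [Finset.card_erase_eq_ite, Finset.card_erase_eq_ite] at e3
    have e4 : p ∈ τ.low m → 0 < (τ.low m).card := fun h => Finset.card_pos.2 ⟨_, h⟩
    have e5 : r ∈ σ.low m → 0 < (σ.low m).card := fun h => Finset.card_pos.2 ⟨_, h⟩
    simp only [e1, e2] at e3 e4 e5
    split_ifs at e3 ⊢ <;> omega
  have hc : (σ.low (σ.height p + 1)).card + σ.height p = p.val := by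
    have e : σ.low (σ.height p + 1) =
        Finset.univ.filter (fun k => k < p ∧ ¬ k < σ.partner k) := by
      ext k
      rw [mem_low, σ.right_iff]
      simp only [Finset.mem_filter, Finset.mem_univ, true_and]
      constructor
      · rintro ⟨h1, h2⟩
        refine ⟨?_, h1⟩
        by_contra h3
        rcases eq_or_lt_of_le (not_lt.1 h3) with rfl | h4
        · exact h1 hp
        · have := σ.height_lt hp h4
          omega
      · rintro ⟨h1, h2⟩
        have := σ.height_mono h1.le
        exact ⟨h2, by omega⟩
    rw [e]
    unfold height
    have e2 := Finset.card_filter_add_card_filter_not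
      (s := (Finset.univ.filter (fun k : Fin (2 * n) => k < p))) (fun k => k < σ.partner k)
    rw [Finset.filter_filter, Finset.filter_filter] at e2
    have e3 : (Finset.univ.filter (fun k : Fin (2 * n) => k < p)).card = p.val := by
      rw [← Fin.card_Iio p]
      congr 1
      ext k
      simp
    rw [e3] at e2
    omega
  refine ⟨?_, ?_, (n - (σ.height p + 1), (σ.low (σ.height p + 1)).card), ?_, ?_, ?_⟩
  · have := Fin.lt_def.1 hp'
    omega
  · have := Fin.lt_def.1 hr'
    have := (τ.partner r).2
    omega
  · rw [mem_young, rowLen_eq, show n - (n - (σ.height p + 1)) = σ.height p + 1 by omega]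
    omega
  · ext ⟨a, c⟩
    rw [Finset.mem_insert, mem_young, mem_young, rowLen_eq, rowLen_eq, hl, Prod.mk_inj]
    split_ifs with h1
    · rw [h1]
      omega
    · constructor
      · omega
      · rintro (⟨h2, h3⟩ | h2)
        · omega
        · omega
  · simp only [diagonal]
    omega

end NCMatching

open NCMatching

variable {n : ℕ}

lemma pt_val (n : ℕ) [NeZero n] (k : ℕ) (hk : 1 ≤ k) (hk' : k ≤ 2 * n) :
    (pt n k : ℕ) = k - 1 := by
  have := NeZero.pos n
  simp only [pt]
  rw [show k + (2 * n - 1) = (k - 1) + 2 * n by omega, Nat.add_mod_right,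
    Nat.mod_eq_of_lt (by omega)]

/-- There is at most one way of adding a box on a given diagonal. -/
lemma Arrow.unique {j : ℕ} {σ τ π : NCMatching n} (h1 : Arrow j σ τ) (h2 : Arrow j σ π) :
    τ = π := by
  obtain ⟨-, -, ⟨a, b⟩, ha, ha', ha''⟩ := h1
  obtain ⟨-, -, ⟨c, d⟩, hc, hc', hc''⟩ := h2
  apply young_injective
  have bnd : ∀ (π : NCMatching n) (a b : ℕ), (a, b) ∈ π.young.cells → a < n := by
    intro π a b h
    simp only [young, Finset.mem_filter, Finset.mem_product, Finset.mem_range] at h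
    exact h.1.1
  have b1 := bnd τ a b (by rw [ha']; simp)
  have b2 := bnd π c d (by rw [hc']; simp)
  have aux : ∀ (π : NCMatching n) (a b c d : ℕ), (a, b) ∉ σ.young.cells →
      π.young.cells = insert (c, d) σ.young.cells → a < c → b ≤ d → False := by
    intro π a b c d ha hc h1 h2
    have m1 : (c, d) ∈ π.young.cells := by rw [hc]; simp
    have m2 : (a, b) ∈ π.young.cells := π.young.isLowerSet (Prod.mk_le_mk.2 ⟨h1.le, h2⟩) m1
    rw [hc, Finset.mem_insert, Prod.mk_inj] at m2
    rcases m2 with m2 | m2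
    · omega
    · exact ha m2
  simp only [diagonal] at ha'' hc''
  rcases lt_trichotomy a c with h | h | h
  · exact (aux π a b c d ha hc' h (by omega)).elim
  · have : b = d := by omega
    subst h this
    ext1
    rw [ha', hc']
  · exact (aux τ c d a b hc ha' h (by omega)).elim

lemma Arrow.card_lt {j : ℕ} {σ π : NCMatching n} (h : Arrow j σ π) :
    σ.young.card < π.young.card := by
  obtain ⟨-, -, x, hx, h', -⟩ := h
  rw [YoungDiagram.card, YoungDiagram.card, h', Finset.card_insert_of_notMem hx]
  omega

variable [NeZero n]

/-- The matchings in `e_j⁻¹(σ)` other than `π`, where `σ ↗_j π`, are at most `σ`. -/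
lemma le_of_tl_eq {j : ℕ} {σ π τ : NCMatching n} (h : Arrow j σ π) (hτ : tl j τ = σ)
    (h2 : τ ≠ π) : τ ≤ σ := by
  have hj := h.1
  have hj' := h.2.1
  have v1 := pt_val n j (by omega) (by omega)
  have v2 := pt_val n (j + 1) (by omega) (by omega)
  by_cases h1 : τ = σ
  · rw [h1]
    exact le_refl σ.young
  have hpr := pt_adjacent n j
  generalize hp : pt n j = p at *
  generalize hr : pt n (j + 1) = r at *
  have hs : ∀ k, σ.partner k = if k = p then r else if k = r then p else if k = τ.partner p
      then τ.partner r else if k = τ.partner r then τ.partner p else τ.partner k := by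
    intro k
    rw [← hτ, ← hp, ← hr]
    rfl
  have hlt : p < r := by rw [Fin.lt_def]; omega
  have hpr' : r.val = p.val + 1 := by omega
  have t1 := τ.partner_partner
  have t2 := τ.partner_ne
  have hne : τ.partner p ≠ r := by
    intro hne
    apply h1
    ext1
    funext k
    rw [hs k]
    have := t1 p
    have := t1 r
    grind
  have hne' : τ.partner r ≠ p := by
    intro h'
    apply hne
    rw [← h', t1]
  have adj : ∀ x, x ≠ p → x ≠ r → (x < p ↔ x < r) := by
    intro i h1 h2
    simp only [Fin.lt_def, ne_eq, Fin.ext_iff] at *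
    omega
  have ax := adj (τ.partner p) (t2 p) hne
  have ay := adj (τ.partner r) hne' (t2 r)
  have sp := hs p
  have sr := hs r
  have sx := hs (τ.partner p)
  have sy := hs (τ.partner r)
  rw [if_pos rfl] at sp
  rw [if_neg hpr.1.symm, if_pos rfl] at sr
  rw [if_neg (t2 p), if_neg hne, if_pos rfl] at sx
  have hxy : τ.partner r ≠ τ.partner p := fun h' => hpr.1 (by rw [← t1 p, ← h', t1])
  rw [if_neg hne', if_neg (t2 r), if_neg hxy, if_pos rfl] at sy
  have so : ∀ k, k ≠ p → k ≠ r → k ≠ τ.partner p → k ≠ τ.partner r →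
      σ.partner k = τ.partner k := by
    intro k k1 k2 k3 k4
    rw [hs k, if_neg k1, if_neg k2, if_neg k3, if_neg k4]
  have tp := t1 p
  have tr := t1 r
  clear hs hτ hpr
  rcases lt_or_gt_of_ne (t2 p) with c1 | c1
  · rcases lt_or_gt_of_ne (t2 r) with c2 | c2
    · -- both partners to the left
      have nc := τ.noncrossing (τ.partner p) (τ.partner r)
      refine young_le_of_move (τ.partner p) p ?_ ?_ ?_ ?_ ?_ ?_
      · grind
      · grind
      · grind
      · grind
      · grind
      · intro k k1 k2
        have := so k k2
        grind
    · -- partners on both sides: this is `π`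
      refine absurd (Arrow.unique ?_ h) h2
      have : j = r.val := by omega
      rw [this]
      refine young_of_swap p r hpr' ?_ ?_ ?_ ?_ ?_
      · grind
      · grind
      · grind
      · grind
      · intro k k1 k2
        have := so k k1 k2
        grind
  · have c1' : r < τ.partner p := by grind
    rcases lt_or_gt_of_ne (t2 r) with c2 | c2
    · have nc := τ.noncrossing (τ.partner r) p
      grind
    · have nc := τ.noncrossing p r
      refine young_le_of_move r (τ.partner r) ?_ ?_ ?_ ?_ ?_ ?_
      · grind
      · grind
      · grind
      · grind
      · grind
      · intro k k1 k2
        have := so k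
        grind

/-- Every noncrossing matching other than `()_n` is obtained from another one by adding a box. -/
lemma exists_arrow (π : NCMatching n) (hπ : π ≠ nested n) :
    ∃ x : ℕ × NCMatching n, Arrow x.1 x.2 π := by
  by_contra hcon
  have noswap : ∀ (p r : Fin (2 * n)), r.val = p.val + 1 → π.partner p < p →
      ¬ r < π.partner r := by
    intro p r hpr hp hr
    apply hcon
    refine ⟨(r.val, tl r.val π), ?_⟩
    have v1 : pt n r.val = p := by
      ext
      rw [pt_val n _ (by omega) (by have := r.2; omega)]
      omega
    have v2 : pt n (r.val + 1) = r := by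
      ext
      rw [pt_val n _ (by omega) (by have := r.2; omega)]
      omega
    have hs : ∀ k, (tl r.val π).partner k = if k = p then r else if k = r then p
        else if k = π.partner p then π.partner r else if k = π.partner r then π.partner p
        else π.partner k := by
      intro k
      simp only [tl, v1, v2]
    have hlt : p < r := by rw [Fin.lt_def]; omega
    have sp := hs p
    have sr := hs r
    have tp := π.partner_partner p
    have tr := π.partner_partner r
    refine young_of_swap p r hpr ?_ ?_ hp hr ?_
    · grind
    · grind
    · intro k k1 k2
      have := hs k
      grind
  have empty : ∀ π : NCMatching n, (∀ (p r : Fin (2 * n)), r.val = p.val + 1 →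
      π.partner p < p → ¬ r < π.partner r) → π.young = ⊥ := by
    intro π h
    have up : ∀ (d : ℕ) (i k : Fin (2 * n)), k.val = i.val + d → π.partner i < i →
        π.partner k < k := by
      intro d
      induction d with
      | zero =>
        intro i k hk hi
        have : k = i := Fin.ext hk
        rw [this]
        exact hi
      | succ d ih =>
        intro i k hk hi
        have hlt : i.val + d < 2 * n := by have := k.2; omega
        exact (π.right_iff k).2 (h ⟨i.val + d, hlt⟩ k (by simp only; omega)
          (ih i ⟨i.val + d, hlt⟩ rfl hi))
    apply le_bot_iff.1
    rintro ⟨r, c⟩ hx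
    have h1 := (π.mem_young r c).1 hx
    obtain ⟨i, hi⟩ := Finset.card_pos.1 (lt_of_le_of_lt (Nat.zero_le _) h1)
    simp only [Finset.mem_filter, Finset.mem_univ, true_and] at hi
    have h2 : π.height i = n := by
      conv_rhs => rw [← π.card_left]
      unfold height
      congr 1
      ext k
      simp only [Finset.mem_filter, Finset.mem_univ, true_and, and_iff_right_iff_imp]
      intro hk
      by_contra hki
      have hle : i.val ≤ k.val := not_lt.1 hki
      exact absurd (up (k.val - i.val) i k (by omega) hi.1) (not_lt.2 hk.le)
    omega
  apply hπ
  apply young_injective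
  rw [empty π noswap, empty (nested n)]
  intro p r hpr hp hr
  simp only [nested, Fin.lt_def, Fin.val_rev] at hp hr
  omega

end

/-! ### Polynomials -/

/-- The field `ℚ(q)`. -/
abbrev K : Type := RatFunc ℚ

/-- The variable `q` of `ℚ(q)`. -/
noncomputable def q : K := RatFunc.X

/-- The polynomial ring `ℚ(q)[z_1, …, z_{2n}]`. -/
abbrev Poly (n : ℕ) : Type := MvPolynomial (Fin (2 * n)) K

open MvPolynomial

/-- Exchanging the variables `z_a` and `z_b`. -/
noncomputable def swapVars {N : ℕ} (a b : Fin N) (f : MvPolynomial (Fin N) K) :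
    MvPolynomial (Fin N) K :=
  rename (Equiv.swap a b) f

lemma sub_dvd_swapVars_sub {N : ℕ} (a b : Fin N) (f : MvPolynomial (Fin N) K) :
    (X b - X a) ∣ swapVars a b f - f := by
  rw [← Ideal.mem_span_singleton, ← Ideal.Quotient.eq]
  have h : (Ideal.Quotient.mkₐ K (Ideal.span {(X b - X a : MvPolynomial (Fin N) K)})).comp
      (rename (Equiv.swap a b)) = Ideal.Quotient.mkₐ K _ := by
    apply MvPolynomial.algHom_ext
    intro i
    have hab : Ideal.Quotient.mk (Ideal.span {(X b - X a : MvPolynomial (Fin N) K)}) (X b) =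
        Ideal.Quotient.mk _ (X a) := by
      rw [Ideal.Quotient.eq, Ideal.mem_span_singleton]
    simp only [AlgHom.comp_apply, rename_X, Ideal.Quotient.mkₐ_eq_mk]
    rw [Equiv.swap_apply_def]
    split_ifs with h1 h2
    · rw [h1, hab]
    · rw [h2, hab]
    · rfl
  exact DFunLike.congr_fun h f

/-- The divided difference `(f(…, z_b, z_a, …) - f) / (z_b - z_a)`; the quotient is a polynomial. -/
noncomputable def divDiff {N : ℕ} (a b : Fin N) (f : MvPolynomial (Fin N) K) :
    MvPolynomial (Fin N) K :=
  (sub_dvd_swapVars_sub a b f).choose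

lemma divDiff_spec {N : ℕ} (a b : Fin N) (f : MvPolynomial (Fin N) K) :
    (X b - X a) * divDiff a b f = swapVars a b f - f :=
  (sub_dvd_swapVars_sub a b f).choose_spec.symm

variable {n : ℕ}

/-- The operator `𝐃_k`, which sends `f` to
`(q z_k - q⁻¹ z_{k+1}) / (z_{k+1} - z_k) * (S_k f - f)`. -/
noncomputable def D [NeZero n] (k : ℕ) (f : Poly n) : Poly n :=
  (C q * X (pt n k) - C q⁻¹ * X (pt n (k + 1))) * divDiff (pt n k) (pt n (k + 1)) f

/-- The substitution `z_j = q² z_i`, `z_k = q⁴ z_i`, that is `q⁴ z_i = q² z_j = z_k`. -/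
noncomputable def wheelSubst (i j k : Fin (2 * n)) : Poly n →ₐ[K] Poly n :=
  aeval (fun m => if m = j then C (q ^ 2) * X i else if m = k then C (q ^ 4) * X i else X m)

/-- The space `W_n[z]` of wheel polynomials of order `n`: the homogeneous polynomials of degree
`n (n - 1)` that satisfy the wheel condition. -/
noncomputable def W (n : ℕ) : Submodule K (Poly n) :=
  homogeneousSubmodule (Fin (2 * n)) K (n * (n - 1)) ⊓
    ⨅ (i : Fin (2 * n)) (j : Fin (2 * n)) (k : Fin (2 * n)) (_ : i < j ∧ j < k),
      LinearMap.ker (wheelSubst i j k).toLinearMap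

/-- The wheel condition in elementwise form. -/
lemma mem_W (p : Poly n) : p ∈ W n ↔ p.IsHomogeneous (n * (n - 1)) ∧
    ∀ i j k : Fin (2 * n), i < j → j < k → wheelSubst i j k p = 0 := by
  simp [W, Submodule.mem_iInf, mem_homogeneousSubmodule]

/-- The wheel polynomial `Ψ_{()_n}`. -/
noncomputable def Psi0 (n : ℕ) [NeZero n] : Poly n :=
  C ((q - q⁻¹) ^ (n * (n - 1)))⁻¹ *
    ∏ i ∈ Finset.Icc 1 n, ∏ j ∈ Finset.Ioc i n,
      (C q * X (pt n i) - C q⁻¹ * X (pt n j)) *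
        (C q * X (pt n (n + i)) - C q⁻¹ * X (pt n (n + j)))

/-- A choice, for each noncrossing matching `π ≠ ()_n`, of a label `j` and a matching `σ` with
`σ ↗_j π`. -/
abbrev ArrowChoice (n : ℕ) : Type :=
  ∀ π : NCMatching n, π ≠ NCMatching.nested n → {x : ℕ × NCMatching n // Arrow x.1 x.2 π}

instance [NeZero n] : Nonempty (ArrowChoice n) :=
  ⟨fun π hπ => ⟨(exists_arrow π hπ).choose, (exists_arrow π hπ).choose_spec⟩⟩

/-- The polynomial `Ψ_π`, computed by the recursion
`Ψ_π = 𝐃_j Ψ_σ - ∑ Ψ_τ`, the sum being over all `τ ∈ e_j⁻¹(σ) \ {σ, π}`, where in each step the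
arrow `σ ↗_j π` is the one given by the choice `s`. -/
noncomputable def Psi [NeZero n] (s : ArrowChoice n) (π : NCMatching n) : Poly n :=
  open Classical in
  if h : π = NCMatching.nested n then Psi0 n
  else
    D (s π h).1.1 (Psi s (s π h).1.2) -
      ∑ τ : {τ : NCMatching n // tl (s π h).1.1 τ = (s π h).1.2 ∧ τ ≠ (s π h).1.2 ∧ τ ≠ π},
        Psi s τ.1
termination_by π.young.card
decreasing_by
  · exact (s π h).2.card_lt
  · exact lt_of_le_of_lt (Finset.card_le_card (le_of_tl_eq (s π h).2 τ.2.1 τ.2.2.2))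
      (s π h).2.card_lt

/-- Every family that satisfies the recursion for all arrows is the family computed above. -/
lemma eq_Psi_of_recursion [NeZero n] (F : NCMatching n → Poly n)
    (h0 : F (NCMatching.nested n) = Psi0 n)
    (h : ∀ (j : ℕ) (σ π : NCMatching n), Arrow j σ π →
      F π = D j (F σ) - ∑ τ ∈ Finset.univ.filter (fun τ => tl j τ = σ) \ {σ, π}, F τ)
    (s : ArrowChoice n) (π : NCMatching n) : F π = Psi s π := by
  have key : ∀ (m : ℕ) (π : NCMatching n), π.young.card = m → F π = Psi s π := by
    intro m
    induction m using Nat.strong_induction_on with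
    | _ m ih =>
      intro π hm
      rw [Psi]
      split_ifs with hπ
      · rw [hπ, h0]
      · have a := (s π hπ).2
        rw [h _ _ _ a, ih _ (hm ▸ a.card_lt) _ rfl]
        congr 1
        rw [Finset.sum_subtype (p := fun τ => tl (s π hπ).1.1 τ = (s π hπ).1.2 ∧
          τ ≠ (s π hπ).1.2 ∧ τ ≠ π) _ (fun τ => by simp)]
        refine Finset.sum_congr rfl (fun τ _ => ih _ ?_ _ rfl)
        rw [← hm]
        exact lt_of_le_of_lt (Finset.card_le_card (le_of_tl_eq a τ.2.1 τ.2.2.2)) a.card_lt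
  exact key _ π rfl

/-- The diagonals of the boxes of a Young diagram, read row by row from top to bottom, and in each
row from left to right. -/
def readingWord (n : ℕ) (μ : YoungDiagram) : List ℕ :=
  (List.range (μ.colLen 0)).flatMap fun r =>
    (List.range (μ.rowLen r)).map fun c => diagonal n (r, c)

/-- The polynomial `D_π`: the operators `𝐃_k` are applied to `Ψ_{()_n}` one after the other, `k`
running through the reading word of the Young diagram of `π`. -/
noncomputable def DPoly [NeZero n] (π : NCMatching n) : Poly n :=
  (readingWord n π.young).foldl (fun f k => D k f) (Psi0 n)

end WheelPoly

/-!
The proof works with values. To a noncrossing matching `π` belongs the point `π.point`, whose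
coordinates are `q⁻¹` at the left-endpoints and `q` at the right-endpoints of `π`. Everything
follows from two facts: these points separate the wheel polynomials, and the matrix of the values of
the `D_π`, or of the `Ψ_π`, at these points is triangular for the order `≤`, with the same nonzero
diagonal entries for both families.

*Separation* (`eq_zero_of_points`). Let `f` be a wheel polynomial and restrict it to `z_j = q² z_i`
for neighbours `i < j`. As a polynomial in `z_i` the restriction has a known root for each of the
other `2n - 2` variables, because of the wheel condition. The quotient by the corresponding linear
factors satisfies the wheel condition for `n - 1`, and has degree at most `(n - 1) (n - 2)`. By
induction on `n` it vanishes if its degree is smaller (`noSmallWheel`) or if `f` vanishes at the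
points of all matchings. So `f` vanishes for `z_j = q² z_i` whenever `i < j` are neighbours; then a
variable between `i` and `j` gives an additional root, and `f` vanishes for `z_j = q² z_i` for all
`i < j`. There are more such hyperplanes than the degree of `f` allows (`eq_zero_of_neighbors`).
The same method shows that a wheel polynomial that is symmetric in three consecutive variables is
zero (`eq_zero_of_symmetric`).

*Triangularity* (`SupportedBelow.D`). The operators `E_k = 𝐃_k - (q + q⁻¹)` satisfy the braid-like
relation `E_k E_{k+1} E_k - E_k = E_{k+1} E_k E_{k+1} - E_{k+1}` on all polynomials. The two sides
are annihilated by `𝐃_k` and `𝐃_{k+1}`, so for a wheel polynomial they are symmetric in three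
consecutive variables and hence zero: on the wheel polynomials the `E_k` satisfy the Temperley-Lieb
relations (`tlMap_tlMap_tlMap`). The value of `E_k f` at the point of `τ` is read off the definition
if exactly one of `k` and `k + 1` is a left-endpoint of `τ`; in the other cases the Temperley-Lieb
relations express it by values of `f` at larger matchings (`eval_EMap_level`). It follows that `𝐃_j`
maps the wheel polynomials supported below `σ` to those supported below `π` if `σ ↗_j π`, and
multiplies the leading value by `-(q + q⁻¹)`. By induction on the diagram, `D_π` (`DPoly_spec`) and
`Ψ_π` (`Psi_spec`) are supported below `π` and have the same nonzero value at the point of `π`.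
-/

namespace WheelPoly

open MvPolynomial

/-! ### Powers of `q` -/

lemma q_pow_ne_one {m : ℕ} (hm : m ≠ 0) : q ^ m ≠ 1 := by
  intro h
  have h1 : (algebraMap (Polynomial ℚ) K) (Polynomial.X ^ m) = algebraMap (Polynomial ℚ) K 1 := by
    rw [map_pow, map_one, RatFunc.algebraMap_X]
    exact h
  have h2 := congrArg Polynomial.natDegree (RatFunc.algebraMap_injective ℚ h1)
  rw [Polynomial.natDegree_X_pow, Polynomial.natDegree_one] at h2
  exact hm h2

lemma q_ne_zero : q ≠ 0 := RatFunc.X_ne_zero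

lemma q_sq_ne_neg_one : q ^ 2 ≠ -1 := fun h =>
  q_pow_ne_one (m := 4) (by norm_num) (by rw [show q ^ 4 = (q ^ 2) ^ 2 by ring, h]; norm_num)

/-! ### Bounded total degree of polynomials in an extra variable -/

section Bounded

variable {σ : Type*}

/-- The total degree of `F`, in the variables `z` and in the extra variable taken together, is at
most `d`. -/
def TotalDegLE (d : ℕ) (F : Polynomial (MvPolynomial σ K)) : Prop :=
  ∀ m, F.coeff m ≠ 0 → (F.coeff m).totalDegree + m ≤ d

lemma TotalDegLE.mono {d e : ℕ} (h : d ≤ e) {F : Polynomial (MvPolynomial σ K)}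
    (hF : TotalDegLE d F) : TotalDegLE e F := fun m hm => (hF m hm).trans h

lemma TotalDegLE.zero (d : ℕ) : TotalDegLE d (0 : Polynomial (MvPolynomial σ K)) := by
  intro m hm
  simp at hm

lemma TotalDegLE.add {d : ℕ} {F G : Polynomial (MvPolynomial σ K)} (hF : TotalDegLE d F)
    (hG : TotalDegLE d G) : TotalDegLE d (F + G) := by
  intro m hm
  rw [Polynomial.coeff_add] at hm ⊢
  have h := totalDegree_add (F.coeff m) (G.coeff m)
  by_cases h1 : F.coeff m = 0
  · rw [h1, zero_add] at hm ⊢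
    exact hG m hm
  by_cases h2 : G.coeff m = 0
  · rw [h2, add_zero]
    exact hF m h1
  have := hF m h1
  have := hG m h2
  rcases le_max_iff.1 h with h | h <;> omega

lemma TotalDegLE.sum {ι : Type*} {d : ℕ} (s : Finset ι) (F : ι → Polynomial (MvPolynomial σ K))
    (h : ∀ i ∈ s, TotalDegLE d (F i)) : TotalDegLE d (∑ i ∈ s, F i) :=
  Finset.sum_induction _ _ (fun _ _ => TotalDegLE.add) (TotalDegLE.zero d) h

lemma TotalDegLE.mul {d e : ℕ} {F G : Polynomial (MvPolynomial σ K)} (hF : TotalDegLE d F)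
    (hG : TotalDegLE e G) : TotalDegLE (d + e) (F * G) := by
  rw [Polynomial.as_sum_range F, Polynomial.as_sum_range G, Finset.sum_mul_sum]
  refine TotalDegLE.sum _ _ fun i _ => TotalDegLE.sum _ _ fun j _ => ?_
  rw [Polynomial.monomial_mul_monomial]
  intro m hm
  rw [Polynomial.coeff_monomial] at hm ⊢
  split_ifs at hm ⊢ with h
  · have h1 := hF i (left_ne_zero_of_mul hm)
    have h2 := hG j (right_ne_zero_of_mul hm)
    have := totalDegree_mul (F.coeff i) (G.coeff j)
    omega
  · exact absurd rfl hm

lemma TotalDegLE.C {d : ℕ} {p : MvPolynomial σ K} (h : p.totalDegree ≤ d) :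
    TotalDegLE d (Polynomial.C p) := by
  intro m hm
  rw [Polynomial.coeff_C] at hm ⊢
  split_ifs at hm ⊢ with h0
  · omega
  · exact absurd rfl hm

lemma TotalDegLE.X : TotalDegLE 1 (Polynomial.X : Polynomial (MvPolynomial σ K)) := by
  intro m hm
  rw [Polynomial.coeff_X] at hm ⊢
  split_ifs at hm ⊢ with h0
  · rw [totalDegree_one]; omega
  · exact absurd rfl hm

lemma TotalDegLE.pow {d : ℕ} {F : Polynomial (MvPolynomial σ K)} (hF : TotalDegLE d F) (k : ℕ) :
    TotalDegLE (d * k) (F ^ k) := by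
  induction k with
  | zero => exact TotalDegLE.C (p := 1) (by simp)
  | succ k ih => rw [pow_succ, Nat.mul_succ]; exact ih.mul hF

/-- Dividing by a monic linear factor lowers the total degree by one. -/
lemma TotalDegLE.of_X_sub_C_mul {d : ℕ} {r : MvPolynomial σ K} (hr : r.totalDegree ≤ 1)
    {F g : Polynomial (MvPolynomial σ K)} (hF : TotalDegLE d F)
    (h : F = (Polynomial.X - Polynomial.C r) * g) (m : ℕ) (hm : g.coeff m ≠ 0) :
    (g.coeff m).totalDegree + m + 1 ≤ d := by
  have key : ∀ k m, g.natDegree < m + k → g.coeff m ≠ 0 →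
      (g.coeff m).totalDegree + m + 1 ≤ d := by
    intro k
    induction k with
    | zero => intro m h1 h2; exact absurd (Polynomial.coeff_eq_zero_of_natDegree_lt h1) h2
    | succ k ih =>
      intro m h1 h2
      have e : g.coeff m = F.coeff (m + 1) + r * g.coeff (m + 1) := by
        rw [h, sub_mul, Polynomial.coeff_sub, Polynomial.coeff_X_mul, Polynomial.coeff_C_mul]
        ring
      have h3 := totalDegree_add (F.coeff (m + 1)) (r * g.coeff (m + 1))
      have h4 := totalDegree_mul r (g.coeff (m + 1))
      have h5 := hF (m + 1)
      have h6 := ih (m + 1) (by omega)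
      rw [e] at h2 ⊢
      by_cases c1 : F.coeff (m + 1) = 0
      · rw [c1, zero_add] at h2 ⊢
        have := h6 (right_ne_zero_of_mul h2)
        omega
      · have := h5 c1
        by_cases c2 : g.coeff (m + 1) = 0
        · rw [c2, mul_zero, add_zero]
          omega
        · have := h6 c2
          rcases le_max_iff.1 h3 with h | h <;> omega
  exact key (g.natDegree + 1) m (by omega) hm

/-! ### Restriction to a line of proportional variables -/

/-- The substitution that replaces the variables `z_l` with `a l ≠ 0` by the multiples `a l * x` of
one new variable `x` and leaves the other variables alone. -/
noncomputable def lineSubst (a : σ → K) : MvPolynomial σ K →ₐ[K] Polynomial (MvPolynomial σ K) :=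
  open Classical in
  aeval (fun l => if a l = 0 then Polynomial.C (X l) else Polynomial.C (C (a l)) * Polynomial.X)

lemma lineSubst_totalDegLE (a : σ → K) (f : MvPolynomial σ K) :
    TotalDegLE f.totalDegree (lineSubst a f) := by
  classical
  conv_rhs => rw [f.as_sum]
  rw [map_sum]
  refine TotalDegLE.sum _ _ fun s hs => ?_
  have hl : ∀ l, TotalDegLE 1 (if a l = 0 then Polynomial.C (X l)
      else Polynomial.C (C (a l)) * Polynomial.X : Polynomial (MvPolynomial σ K)) := by
    intro l
    split_ifs
    · exact TotalDegLE.C (totalDegree_X l).le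
    · simpa using (TotalDegLE.C (p := C (a l)) (d := 0) (by simp)).mul TotalDegLE.X
  have hprod : ∀ t : Finset σ, TotalDegLE (∑ l ∈ t, s l) (∏ l ∈ t, (if a l = 0 then
      Polynomial.C (X l) else Polynomial.C (C (a l)) * Polynomial.X :
        Polynomial (MvPolynomial σ K)) ^ s l) := by
    intro t
    induction t using Finset.induction_on with
    | empty => exact TotalDegLE.C (p := 1) (by simp)
    | insert x t hx ih =>
      rw [Finset.sum_insert hx, Finset.prod_insert hx]
      simpa using ((hl x).pow (s x)).mul ih
  rw [lineSubst, aeval_monomial]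
  refine TotalDegLE.mono ?_ ((TotalDegLE.C (p := C (coeff s f)) (d := 0) (by simp)).mul
    (hprod s.support))
  rw [zero_add]
  exact le_totalDegree hs

/-- The point of the line that has the parameter `x` and lies over `z`. -/
noncomputable def linePoint (a : σ → K) (z : σ → K) (x : K) : σ → K :=
  open Classical in fun l => if a l = 0 then z l else a l * x

lemma eval_lineSubst (a : σ → K) (f : MvPolynomial σ K) (z : σ → K) (x : K) :
    ((lineSubst a f).map (eval z)).eval x = eval (linePoint a z x) f := by
  classical
  have h : ((Polynomial.evalRingHom x).comp ((Polynomial.mapRingHom (eval z)).comp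
      (lineSubst a : MvPolynomial σ K →+* Polynomial (MvPolynomial σ K)))) =
      eval (linePoint a z x) := by
    apply MvPolynomial.ringHom_ext
    · intro c
      simp [lineSubst]
    · intro l
      simp only [lineSubst, linePoint, RingHom.comp_apply, RingHom.coe_coe, aeval_X, eval_X,
        Polynomial.coe_mapRingHom, Polynomial.coe_evalRingHom]
      split_ifs <;> simp
  exact RingHom.congr_fun h f

lemma eval_eval_lineSubst (a : σ → K) (f : MvPolynomial σ K) (z : σ → K) (r : MvPolynomial σ K) :
    eval z ((lineSubst a f).eval r) = eval (linePoint a z (eval z r)) f := by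
  rw [← eval_lineSubst, Polynomial.eval_map, Polynomial.eval₂_hom]

/-- The product of the linear factors of a set of roots, the pair `(c, k)` standing for the root
`c * z_k`. -/
noncomputable def rootProd (T : Finset (K × σ)) : Polynomial (MvPolynomial σ K) :=
  ∏ t ∈ T, (Polynomial.X - Polynomial.C (C t.1 * X t.2))

lemma C_mul_X_inj {c d : K} {k l : σ} (hc : c ≠ 0)
    (h : (C c * X k : MvPolynomial σ K) = C d * X l) : (c, k) = (d, l) := by
  rw [C_mul_X_eq_monomial, C_mul_X_eq_monomial, monomial_eq_monomial_iff] at h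
  rcases h with ⟨h1, h2⟩ | ⟨h1, -⟩
  · rw [h2, (Finsupp.single_left_injective one_ne_zero) h1]
  · exact absurd h1 hc

/-- Known distinct roots of the restriction of `f` to a line can be divided out, and each of them
lowers the total degree of the quotient by one. -/
lemma lineSubst_factor (a : σ → K) (f : MvPolynomial σ K) (T : Finset (K × σ))
    (hT : ∀ t ∈ T, t.1 ≠ 0)
    (hf : ∀ t ∈ T, ∀ z, eval (linePoint a z (t.1 * z t.2)) f = 0) :
    ∃ g, lineSubst a f = rootProd T * g ∧
      ∀ m, g.coeff m ≠ 0 → (g.coeff m).totalDegree + m + T.card ≤ f.totalDegree := by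
  classical
  induction T using Finset.induction_on with
  | empty => exact ⟨lineSubst a f, by simp [rootProd], lineSubst_totalDegLE a f⟩
  | insert t T ht ih =>
    obtain ⟨g, hg, hd⟩ := ih (fun s hs => hT s (Finset.mem_insert_of_mem hs))
      (fun s hs => hf s (Finset.mem_insert_of_mem hs))
    have hroot : g.eval (C t.1 * X t.2) = 0 := by
      have h0 : (lineSubst a f).eval (C t.1 * X t.2) = 0 := by
        apply MvPolynomial.funext
        intro z
        rw [eval_eval_lineSubst, map_zero]
        simpa using hf t (Finset.mem_insert_self t T) z
      rw [hg, Polynomial.eval_mul] at h0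
      refine (mul_eq_zero.1 h0).resolve_left ?_
      rw [rootProd, Polynomial.eval_prod]
      refine Finset.prod_ne_zero_iff.2 ?_
      intro s hs h
      rw [Polynomial.eval_sub, Polynomial.eval_X, Polynomial.eval_C, sub_eq_zero] at h
      have := C_mul_X_inj (hT t (Finset.mem_insert_self t T)) h
      exact ht (by rw [show t = s from this]; exact hs)
    obtain ⟨g', hg'⟩ := Polynomial.dvd_iff_isRoot.2 hroot
    refine ⟨g', ?_, ?_⟩
    · rw [hg, hg', rootProd, rootProd, Finset.prod_insert ht]
      ring
    · rw [Finset.card_insert_of_notMem ht]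
      intro m hm
      by_cases hle : T.card ≤ f.totalDegree
      · have := TotalDegLE.of_X_sub_C_mul (d := f.totalDegree - T.card)
          (r := C t.1 * X t.2) ?_ (F := g) (fun m hm => by have := hd m hm; omega) hg' m hm
        · omega
        · refine (totalDegree_mul _ _).trans ?_
          rw [totalDegree_C, totalDegree_X]
      · have : g = 0 := by
          ext1 m
          by_contra h
          have := hd m h
          omega
        rw [this] at hg'
        have h0 := (mul_eq_zero.1 hg'.symm).resolve_left (Polynomial.X_sub_C_ne_zero _)
        rw [h0] at hm
        simp at hm

lemma rootProd_map_ne_zero (T : Finset (K × σ)) (z : σ → K) :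
    (rootProd T).map (eval z) ≠ 0 := by
  rw [rootProd, Polynomial.map_prod, Finset.prod_ne_zero_iff]
  intro t _
  rw [Polynomial.map_sub, Polynomial.map_X, Polynomial.map_C]
  exact Polynomial.X_sub_C_ne_zero _

/-- If `f` vanishes on the line over `z`, then the coefficients of the quotient vanish at `z`. -/
lemma eval_coeff_eq_zero {a : σ → K} {f : MvPolynomial σ K} {T : Finset (K × σ)}
    {g : Polynomial (MvPolynomial σ K)} (hg : lineSubst a f = rootProd T * g) (z : σ → K)
    (h : ∀ x, eval (linePoint a z x) f = 0) (m : ℕ) : eval z (g.coeff m) = 0 := by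
  have h0 : (lineSubst a f).map (eval z) = 0 := by
    apply Polynomial.funext
    intro x
    rw [eval_lineSubst, h, Polynomial.eval_zero]
  rw [hg, Polynomial.map_mul] at h0
  have h1 := (mul_eq_zero.1 h0).resolve_left (rootProd_map_ne_zero T z)
  rw [← Polynomial.coeff_map, h1, Polynomial.coeff_zero]

end Bounded

/-! ### Polynomials with the wheel condition on a set of variables -/

section Wheel

variable {σ : Type*} [LinearOrder σ]

/-- `f` vanishes on the hyperplane `z_j = q² z_i`. -/
def VanishOn (i j : σ) (f : MvPolynomial σ K) : Prop :=
  ∀ z : σ → K, z j = q ^ 2 * z i → eval z f = 0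

/-- The wheel condition for the variables in `S`, the other variables being parameters. -/
def WheelOn (S : Finset σ) (f : MvPolynomial σ K) : Prop :=
  ∀ i ∈ S, ∀ j ∈ S, ∀ k ∈ S, i < j → j < k → ∀ z : σ → K, z j = q ^ 2 * z i → z k = q ^ 4 * z i →
    eval z f = 0

/-- `i < j` are neighbours in `S`. -/
def Neighbors (S : Finset σ) (i j : σ) : Prop :=
  i ∈ S ∧ j ∈ S ∧ i < j ∧ ∀ k ∈ S, ¬ (i < k ∧ k < j)

/-- The coefficients of the substitution `z_i = x`, `z_j = q² x`. -/
noncomputable def pairCoef (i j : σ) (l : σ) : K := if l = i then 1 else if l = j then q ^ 2 else 0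

lemma linePoint_pair_left (i j : σ) (z : σ → K) (x : K) : linePoint (pairCoef i j) z x i = x := by
  simp [linePoint, pairCoef]

lemma linePoint_pair_right {i j : σ} (h : i ≠ j) (z : σ → K) (x : K) :
    linePoint (pairCoef i j) z x j = q ^ 2 * x := by
  simp [linePoint, pairCoef, h.symm, q_ne_zero]

lemma linePoint_pair_other {i j l : σ} (hi : l ≠ i) (hj : l ≠ j) (z : σ → K) (x : K) :
    linePoint (pairCoef i j) z x l = z l := by
  simp [linePoint, pairCoef, hi, hj]

lemma vanishOn_of_lineSubst {i j : σ} (h : i ≠ j) {f : MvPolynomial σ K}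
    (hf : lineSubst (pairCoef i j) f = 0) : VanishOn i j f := by
  intro z hz
  have h1 := eval_lineSubst (pairCoef i j) f z (z i)
  rw [hf, Polynomial.map_zero, Polynomial.eval_zero] at h1
  rw [h1]
  congr 2
  funext l
  by_cases hi : l = i
  · rw [hi, linePoint_pair_left]
  by_cases hj : l = j
  · rw [hj, linePoint_pair_right h, hz]
  rw [linePoint_pair_other hi hj]

/-- For `k` outside of the interval from `i` to `j`, the wheel condition makes `z_i = c z_k` a zero
of the restriction to `z_j = q² z_i`, where `c` is this number; for `k` inside, the vanishing for
`z_j = q² z_k` does. -/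
noncomputable def rootCoef (i j k : σ) : K := if k < i then q ^ 2 else if j < k then (q ^ 4)⁻¹ else 1

/-- The variables of `S` other than `z_i` and `z_j`, with the coefficients `rootCoef`. -/
noncomputable def wheelRoots (S : Finset σ) (i j : σ) : Finset (K × σ) :=
  ((S.erase i).erase j).map ⟨fun k => (rootCoef i j k, k), fun _ _ h => (Prod.mk.inj h).2⟩

lemma mem_wheelRoots {S : Finset σ} {i j : σ} {t : K × σ} :
    t ∈ wheelRoots S i j ↔ (t.2 ∈ S ∧ t.2 ≠ i ∧ t.2 ≠ j) ∧ t.1 = rootCoef i j t.2 := by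
  obtain ⟨c, k⟩ := t
  simp only [wheelRoots, Finset.mem_map, Finset.mem_erase]
  constructor
  · rintro ⟨a, h1, h2⟩
    obtain ⟨rfl, rfl⟩ := Prod.mk.inj h2
    exact ⟨⟨h1.2.2, h1.2.1, h1.1⟩, rfl⟩
  · rintro ⟨h1, h2⟩
    exact ⟨k, ⟨h1.2.2, h1.2.1, h1.1⟩, Prod.ext h2.symm rfl⟩

lemma card_erase_pair {S : Finset σ} {i j : σ} (hi : i ∈ S) (hj : j ∈ S) (h : i ≠ j) :
    ((S.erase i).erase j).card + 2 = S.card := by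
  have h1 := Finset.card_erase_add_one hi
  have h2 := Finset.card_erase_add_one (Finset.mem_erase.2 ⟨h.symm, hj⟩)
  omega

lemma card_wheelRoots {S : Finset σ} {i j : σ} (hi : i ∈ S) (hj : j ∈ S) (h : i ≠ j) :
    (wheelRoots S i j).card + 2 = S.card := by
  rw [wheelRoots, Finset.card_map, card_erase_pair hi hj h]

lemma rootCoef_ne_zero (i j k : σ) : rootCoef i j k ≠ 0 := by
  have := q_ne_zero
  unfold rootCoef
  split_ifs <;> simp [this]

lemma wheelRoots_spec {S : Finset σ} {i j : σ} (hi : i ∈ S) (hj : j ∈ S) (h : i < j)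
    {f : MvPolynomial σ K} (hf : WheelOn S f)
    (hb : ∀ k ∈ S, i < k → k < j → VanishOn k j f) :
    ∀ t ∈ wheelRoots S i j, ∀ z, eval (linePoint (pairCoef i j) z (t.1 * z t.2)) f = 0 := by
  have hq := q_ne_zero
  rintro ⟨c, k⟩ ht z
  obtain ⟨⟨hk, hki, hkj⟩, hc⟩ := mem_wheelRoots.1 ht
  dsimp only at hk hki hkj hc
  subst hc
  have e1 := linePoint_pair_left i j z (rootCoef i j k * z k)
  have e2 := linePoint_pair_right h.ne z (rootCoef i j k * z k)
  have e3 := linePoint_pair_other hki hkj z (rootCoef i j k * z k)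
  simp only
  by_cases c1 : k < i
  · refine hf k hk i hi j hj c1 h _ ?_ ?_
    · rw [e1, e3, rootCoef, if_pos c1]
    · rw [e2, e3, rootCoef, if_pos c1]
      ring
  by_cases c2 : j < k
  · refine hf i hi j hj k hk h c2 _ ?_ ?_
    · rw [e1, e2]
    · rw [e1, e3, rootCoef, if_neg c1, if_pos c2]
      field_simp
  · refine hb k hk (lt_of_le_of_ne (not_lt.1 c1) hki.symm) (lt_of_le_of_ne (not_lt.1 c2) hkj) _ ?_
    rw [e2, e3, rootCoef, if_neg c1, if_neg c2, one_mul]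

lemma WheelOn.coeff {S : Finset σ} {i j : σ} {f : MvPolynomial σ K} (hf : WheelOn S f)
    {T : Finset (K × σ)} {g : Polynomial (MvPolynomial σ K)}
    (hg : lineSubst (pairCoef i j) f = rootProd T * g) (m : ℕ) :
    WheelOn ((S.erase i).erase j) (g.coeff m) := by
  intro a ha b hb c hc hab hbc z h1 h2
  simp only [Finset.mem_erase] at ha hb hc
  refine eval_coeff_eq_zero hg z (fun x => hf a ha.2.2 b hb.2.2 c hc.2.2 hab hbc _ ?_ ?_) m
  · rw [linePoint_pair_other hb.2.1 hb.1, linePoint_pair_other ha.2.1 ha.1, h1]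
  · rw [linePoint_pair_other hc.2.1 hc.1, linePoint_pair_other ha.2.1 ha.1, h2]

/-- A polynomial that vanishes on all the hyperplanes `z_j = q² z_i` with `i < j` in `S` is zero if
its degree is less than the number of these hyperplanes. -/
lemma eq_zero_of_vanishOn (S : Finset σ) (f : MvPolynomial σ K)
    (h : ∀ i ∈ S, ∀ j ∈ S, i < j → VanishOn i j f) (hd : f.totalDegree < S.card.choose 2) :
    f = 0 := by
  classical
  induction S using Finset.induction_on_max generalizing f with
  | empty => simp at hd
  | insert M S hM ih =>
    have hMS : M ∉ S := fun h => lt_irrefl _ (hM M h)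
    let a : σ → K := fun l => if l = M then 1 else 0
    have aM : ∀ z x, linePoint a z x M = x := by simp [linePoint, a]
    have aO : ∀ z x l, l ≠ M → linePoint a z x l = z l := by
      intro z x l hl
      simp [linePoint, a, hl]
    obtain ⟨g, hg, hgd⟩ := lineSubst_factor a f (S.image (fun k => (q ^ 2, k)))
      (by
        intro t ht
        obtain ⟨k, _, rfl⟩ := Finset.mem_image.1 ht
        exact pow_ne_zero 2 q_ne_zero)
      (by
        intro t ht z
        obtain ⟨k, hk, rfl⟩ := Finset.mem_image.1 ht
        refine h k (Finset.mem_insert_of_mem hk) M (Finset.mem_insert_self _ _) (hM k hk) _ ?_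
        rw [aM, aO _ _ _ (hM k hk).ne])
    rw [Finset.card_image_of_injective _ (fun a b h => (Prod.mk.inj h).2)] at hgd
    rw [Finset.card_insert_of_notMem hMS, Nat.choose_succ_succ' _ 1, Nat.choose_one_right,
      one_add_one_eq_two] at hd
    have hg0 : g = 0 := by
      ext1 m
      rw [Polynomial.coeff_zero]
      by_contra hm
      have := hgd m hm
      refine hm (ih _ ?_ (by omega))
      intro i hi j hj hij z hz
      refine eval_coeff_eq_zero hg z (fun x => h i (Finset.mem_insert_of_mem hi) j
        (Finset.mem_insert_of_mem hj) hij _ ?_) m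
      rw [aO _ _ _ (hM i hi).ne, aO _ _ _ (hM j hj).ne, hz]
    rw [hg0, mul_zero] at hg
    apply MvPolynomial.funext
    intro z
    have h1 := eval_lineSubst a f z (z M)
    rw [hg, Polynomial.map_zero, Polynomial.eval_zero] at h1
    rw [map_zero, h1]
    congr 2
    funext l
    by_cases hl : l = M
    · rw [hl, aM]
    · rw [aO _ _ _ hl]

/-- There are no nonzero polynomials of degree less than `n (n - 1)` with the wheel condition on
`2n` variables. -/
def NoSmallWheel (σ : Type*) [LinearOrder σ] (n : ℕ) : Prop :=
  ∀ (S : Finset σ) (f : MvPolynomial σ K), S.card = 2 * n → WheelOn S f →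
    f.totalDegree < n * (n - 1) → f = 0

lemma vanishOn_of_roots {n : ℕ} (hn : NoSmallWheel σ n) {S : Finset σ} (hS : S.card = 2 * (n + 1))
    {f : MvPolynomial σ K} (hf : WheelOn S f) {i j : σ} (hi : i ∈ S) (hj : j ∈ S) (h : i ≠ j)
    (T : Finset (K × σ)) (hT : ∀ t ∈ T, t.1 ≠ 0)
    (hTf : ∀ t ∈ T, ∀ z, eval (linePoint (pairCoef i j) z (t.1 * z t.2)) f = 0)
    (hd : f.totalDegree < n * (n - 1) + T.card) : VanishOn i j f := by
  obtain ⟨g, hg, hgd⟩ := lineSubst_factor _ f T hT hTf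
  apply vanishOn_of_lineSubst h
  have hg0 : g = 0 := by
    ext1 m
    rw [Polynomial.coeff_zero]
    by_contra hm
    have := hgd m hm
    refine hm (hn ((S.erase i).erase j) _ ?_ (hf.coeff hg m) (by omega))
    have := card_erase_pair hi hj h
    omega
  rw [hg, hg0, mul_zero]

/-- With one root in addition to those that the wheel condition provides, the restriction to
`z_j = q² z_i` has too many zeros for a polynomial of degree `n (n + 1)`. -/
lemma vanishOn_of_extra_root {n : ℕ} (hn : NoSmallWheel σ n) {S : Finset σ}
    (hS : S.card = 2 * (n + 1)) {f : MvPolynomial σ K} (hf : WheelOn S f)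
    (hd : f.totalDegree ≤ (n + 1) * n) {i j : σ} (hi : i ∈ S) (hj : j ∈ S) (h : i < j)
    (hb : ∀ k ∈ S, i < k → k < j → VanishOn k j f) (c : K) (k : σ) (hc : c ≠ 0)
    (hck : c ≠ rootCoef i j k)
    (hr : ∀ z, eval (linePoint (pairCoef i j) z (c * z k)) f = 0) : VanishOn i j f := by
  classical
  have hnot : (c, k) ∉ wheelRoots S i j := fun h => hck (mem_wheelRoots.1 h).2
  refine vanishOn_of_roots hn hS hf hi hj h.ne (insert (c, k) (wheelRoots S i j)) ?_ ?_ ?_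
  · intro t ht
    rcases Finset.mem_insert.1 ht with rfl | ht
    · exact hc
    · rw [(mem_wheelRoots.1 ht).2]
      exact rootCoef_ne_zero _ _ _
  · intro t ht
    rcases Finset.mem_insert.1 ht with rfl | ht
    · exact hr
    · exact wheelRoots_spec hi hj h hf hb t ht
  · rw [Finset.card_insert_of_notMem hnot]
    have h1 := card_wheelRoots hi hj h.ne
    have h2 : (n + 1) * n = n * (n - 1) + 2 * n := by
      cases n with
      | zero => rfl
      | succ n => rw [Nat.add_sub_cancel]; ring
    omega

/-- If the polynomial vanishes on `z_j = q² z_i` for all neighbours `i < j`, then a variable between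
`i` and `j` provides an additional root, so it vanishes for all `i < j`. -/
lemma eq_zero_of_neighbors {n : ℕ} (hn : NoSmallWheel σ n) {S : Finset σ}
    (hS : S.card = 2 * (n + 1)) {f : MvPolynomial σ K} (hf : WheelOn S f)
    (hd : f.totalDegree ≤ (n + 1) * n)
    (h : ∀ i j, Neighbors S i j → VanishOn i j f) : f = 0 := by
  have hq := q_ne_zero
  have key : ∀ m, ∀ i ∈ S, ∀ j ∈ S, i < j → (S.filter (fun k => i < k ∧ k < j)).card = m →
      VanishOn i j f := by
    intro m
    induction m using Nat.strong_induction_on with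
    | _ m ih =>
      intro i hi j hj hij hm
      by_cases hadj : ∀ k ∈ S, ¬ (i < k ∧ k < j)
      · exact h i j ⟨hi, hj, hij, hadj⟩
      push Not at hadj
      obtain ⟨k, hk, hik, hkj⟩ := hadj
      have sub : ∀ a ∈ S, ∀ b ∈ S, i ≤ a → b ≤ j → a < b → (i < a ∨ b < j) →
          VanishOn a b f := by
        intro a ha b hb hia hbj hab hor
        refine ih _ ?_ a ha b hb hab rfl
        rw [← hm]
        apply Finset.card_lt_card
        refine ⟨fun x hx => ?_, fun hsub => ?_⟩
        · simp only [Finset.mem_filter] at hx ⊢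
          exact ⟨hx.1, hia.trans_lt hx.2.1, hx.2.2.trans_le hbj⟩
        · rcases hor with hor | hor
          · have := hsub (Finset.mem_filter.2 ⟨ha, hor, hab.trans_le hbj⟩)
            simp at this
          · have := hsub (Finset.mem_filter.2 ⟨hb, hia.trans_lt hab, hor⟩)
            simp at this
      refine vanishOn_of_extra_root hn hS hf hd hi hj hij
        (fun l hl h1 h2 => sub l hl j hj h1.le le_rfl h2 (Or.inl h1)) (q ^ 2)⁻¹ k (by simp [hq])
        ?_ ?_
      · rw [rootCoef, if_neg hik.not_gt, if_neg hkj.not_gt]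
        intro h
        exact q_pow_ne_one (m := 2) two_ne_zero (inv_eq_one.1 h)
      · intro z
        refine sub i hi k hk le_rfl hkj.le hik (Or.inr hkj) _ ?_
        rw [linePoint_pair_left, linePoint_pair_other hik.ne' hkj.ne]
        field_simp
  refine eq_zero_of_vanishOn S f (fun i hi j hj hij => key _ i hi j hj hij rfl) ?_
  rw [hS, Nat.choose_two_right]
  have : 2 * (n + 1) * (2 * (n + 1) - 1) / 2 = (n + 1) * (2 * n + 1) := by
    rw [show 2 * (n + 1) - 1 = 2 * n + 1 by omega, mul_assoc]
    exact Nat.mul_div_cancel_left _ two_pos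
  rw [this]
  nlinarith

lemma noSmallWheel (n : ℕ) : NoSmallWheel σ n := by
  induction n with
  | zero => intro S f _ _ h; simp at h
  | succ n ih =>
    intro S f hS hf hd
    rw [Nat.add_sub_cancel] at hd
    refine eq_zero_of_neighbors ih hS hf hd.le ?_
    rintro i j ⟨hi, hj, hij, hadj⟩
    refine vanishOn_of_roots ih hS hf hi hj hij.ne (wheelRoots S i j)
      (fun t ht => by rw [(mem_wheelRoots.1 ht).2]; exact rootCoef_ne_zero _ _ _)
      (wheelRoots_spec hi hj hij hf (fun k hk h1 h2 => absurd ⟨h1, h2⟩ (hadj k hk))) ?_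
    have h1 := card_wheelRoots hi hj hij.ne
    have h2 : (n + 1) * n = n * (n - 1) + 2 * n := by
      cases n with
      | zero => rfl
      | succ n => rw [Nat.add_sub_cancel]; ring
    omega

/-- A polynomial of degree `n (n - 1)` with the wheel condition is zero if it vanishes both on
`z_r = q² z_p` and on `z_p = q² z_r` for some neighbours `p` and `r`. -/
lemma eq_zero_of_vanishOn_both (n : ℕ) (S : Finset σ) (f : MvPolynomial σ K)
    (hS : S.card = 2 * n) (hf : WheelOn S f) (hd : f.totalDegree ≤ n * (n - 1)) (p r : σ)
    (hpr : Neighbors S p r) (h1 : VanishOn p r f) (h2 : VanishOn r p f) : f = 0 := by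
  have hq := q_ne_zero
  induction n generalizing S f with
  | zero =>
    rw [mul_zero, Finset.card_eq_zero] at hS
    have := hpr.1
    rw [hS] at this
    simp at this
  | succ n ih =>
    rw [Nat.add_sub_cancel] at hd
    obtain ⟨hp, hr, hlt, hno⟩ := hpr
    refine eq_zero_of_neighbors (noSmallWheel n) hS hf hd ?_
    rintro i j ⟨hi, hj, hij, hadj⟩
    have hb : ∀ k ∈ S, i < k → k < j → VanishOn k j f :=
      fun k hk h1 h2 => absurd ⟨h1, h2⟩ (hadj k hk)
    by_cases c1 : i = p
    · subst c1
      have a1 := hadj r hr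
      have a2 := hno j hj
      have : j = r := by
        rcases lt_trichotomy j r with h | h | h
        · exact absurd ⟨hij, h⟩ a2
        · exact h
        · exact absurd ⟨hlt, h⟩ a1
      rw [this]
      exact h1
    by_cases c2 : j = r
    · subst c2
      have a1 := hadj p hp
      have a2 := hno i hi
      rcases lt_trichotomy i p with h | h | h
      · exact absurd ⟨h, hlt⟩ a1
      · exact absurd h c1
      · exact absurd ⟨h, hij⟩ a2
    by_cases c3 : j = p
    · subst c3
      refine vanishOn_of_extra_root (noSmallWheel n) hS hf hd hi hj hij hb 1 r one_ne_zero ?_ ?_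
      · rw [rootCoef, if_neg (hij.trans hlt).not_gt, if_pos hlt]
        intro h
        exact q_pow_ne_one (m := 4) (by norm_num) (inv_eq_one.1 h.symm)
      · intro z
        refine h2 _ ?_
        rw [linePoint_pair_right hij.ne, linePoint_pair_other (hij.trans hlt).ne' hlt.ne', one_mul]
    by_cases c4 : i = r
    · subst c4
      refine vanishOn_of_extra_root (noSmallWheel n) hS hf hd hi hj hij hb (q ^ 2)⁻¹ p
        (by simp [hq]) ?_ ?_
      · rw [rootCoef, if_pos hlt]
        intro h
        refine q_pow_ne_one (m := 4) (by norm_num) ?_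
        rw [show q ^ 4 = q ^ 2 * q ^ 2 by ring]
        nth_rewrite 1 [← h]
        exact inv_mul_cancel₀ (pow_ne_zero 2 hq)
      · intro z
        refine h2 _ ?_
        rw [linePoint_pair_left, linePoint_pair_other hlt.ne (hlt.trans hij).ne]
        field_simp
    obtain ⟨g, hg, hgd⟩ := lineSubst_factor (pairCoef i j) f (wheelRoots S i j)
      (fun t ht => by rw [(mem_wheelRoots.1 ht).2]; exact rootCoef_ne_zero _ _ _)
      (wheelRoots_spec hi hj hij hf hb)
    apply vanishOn_of_lineSubst hij.ne
    have e1 := card_wheelRoots hi hj hij.ne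
    have e2 := card_erase_pair hi hj hij.ne
    have e3 : (n + 1) * n = n * (n - 1) + 2 * n := by
      cases n with
      | zero => rfl
      | succ n => rw [Nat.add_sub_cancel]; ring
    have hg0 : g = 0 := by
      ext1 m
      rw [Polynomial.coeff_zero]
      by_contra hm
      have := hgd m hm
      refine hm (ih ((S.erase i).erase j) _ (by omega) (hf.coeff hg m) (by omega) ?_ ?_ ?_)
      · refine ⟨?_, ?_, hlt, fun k hk => hno k (Finset.mem_of_mem_erase (Finset.mem_of_mem_erase hk))⟩
        · simp only [Finset.mem_erase]
          exact ⟨Ne.symm c3, Ne.symm c1, hp⟩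
        · simp only [Finset.mem_erase]
          exact ⟨Ne.symm c2, Ne.symm c4, hr⟩
      · intro z hz
        refine eval_coeff_eq_zero hg z (fun x => h1 _ ?_) m
        rw [linePoint_pair_other (Ne.symm c1) (Ne.symm c3),
          linePoint_pair_other (Ne.symm c4) (Ne.symm c2), hz]
      · intro z hz
        refine eval_coeff_eq_zero hg z (fun x => h2 _ ?_) m
        rw [linePoint_pair_other (Ne.symm c1) (Ne.symm c3),
          linePoint_pair_other (Ne.symm c4) (Ne.symm c2), hz]
    rw [hg, hg0, mul_zero]

/-- `p` restricts to a noncrossing matching of the points in `S`. -/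
def MatchingOn (S : Finset σ) (p : σ → σ) : Prop :=
  (∀ k ∈ S, p k ∈ S ∧ p (p k) = k ∧ p k ≠ k) ∧
    ∀ a ∈ S, ∀ b ∈ S, ¬ (a < b ∧ b < p a ∧ p a < p b)

/-- The point whose coordinates are `q⁻¹` at the left-endpoints and `q` at the right-endpoints. -/
noncomputable def matchingPoint (p : σ → σ) (k : σ) : K := if k < p k then q⁻¹ else q

/-- Adding an arch between two neighbours. -/
lemma MatchingOn.extend {S : Finset σ} {i j : σ} (hij : Neighbors S i j) {p : σ → σ}
    (hp : MatchingOn ((S.erase i).erase j) p) :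
    MatchingOn S (fun k => if k = i then j else if k = j then i else p k) := by
  obtain ⟨hi, hj, hlt, hno⟩ := hij
  obtain ⟨h1, h2⟩ := hp
  simp only [Finset.mem_erase] at h1 h2
  refine ⟨fun k hk => ?_, fun a ha b hb => ?_⟩
  · have := h1 k
    grind
  · have := h1 a
    have := h1 b
    have := h2 a
    have := hno a ha
    have := hno b hb
    have := hno (p a)
    have := hno (p b)
    grind

lemma rootProd_eval_ne_zero {S : Finset σ} {i j : σ} (hij : Neighbors S i j) (p : σ → σ) :
    ((rootProd (wheelRoots S i j)).map (eval (matchingPoint p))).eval q⁻¹ ≠ 0 := by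
  have hq := q_ne_zero
  obtain ⟨hi, hj, hlt, hno⟩ := hij
  have aux : ∀ m : ℕ, m ≠ 0 → ∀ a b : K, a = q ^ m * b → b ≠ 0 → a ≠ b := by
    intro m hm a b h hb hab
    rw [hab] at h
    exact q_pow_ne_one hm (mul_right_cancel₀ hb (by rw [← h, one_mul]))
  rw [rootProd, Polynomial.map_prod, Polynomial.eval_prod]
  refine Finset.prod_ne_zero_iff.2 ?_
  rintro ⟨c, k⟩ ht
  obtain ⟨⟨hk, hki, hkj⟩, hc⟩ := mem_wheelRoots.1 ht
  dsimp only at hk hki hkj hc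
  subst hc
  rw [Polynomial.map_sub, Polynomial.map_X, Polynomial.map_C, map_mul, eval_C, eval_X,
    Polynomial.eval_sub, Polynomial.eval_X, Polynomial.eval_C, sub_ne_zero, rootCoef, matchingPoint]
  have := hno k hk
  split_ifs with c1 c2 c2 c3 c3
  · exact (aux 2 (by norm_num) _ _ (by field_simp) (by simp [hq])).symm
  · exact (aux 4 (by norm_num) _ _ (by field_simp) (by simp [hq])).symm
  · exact aux 4 (by norm_num) _ _ (by field_simp) (by simp [hq])
  · exact aux 2 (by norm_num) _ _ (by field_simp) (by simp [hq])
  all_goals exact absurd ⟨lt_of_le_of_ne (not_lt.1 c1) hki.symm,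
    lt_of_le_of_ne (not_lt.1 c2) hkj⟩ this

/-- A polynomial of degree `n (n - 1)` with the wheel condition is determined by its values at the
points that belong to the noncrossing matchings. -/
lemma eq_zero_of_matchingPoints (n : ℕ) (S : Finset σ) (f : MvPolynomial σ K)
    (hS : S.card = 2 * n) (hf : WheelOn S f) (hd : f.totalDegree ≤ n * (n - 1))
    (h : ∀ p, MatchingOn S p → eval (matchingPoint p) f = 0) : f = 0 := by
  have hq := q_ne_zero
  induction n generalizing S f with
  | zero =>
    rw [mul_zero, Finset.card_eq_zero] at hS
    subst hS
    have h1 := totalDegree_eq_zero_iff_eq_C.1 (Nat.le_zero.1 (by simpa using hd))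
    have h2 := h id ⟨by simp, by simp⟩
    rw [h1, eval_C] at h2
    rw [h1, h2, map_zero]
  | succ n ih =>
    rw [Nat.add_sub_cancel] at hd
    refine eq_zero_of_neighbors (noSmallWheel n) hS hf hd ?_
    intro i j hij
    obtain ⟨hi, hj, hlt, hadj⟩ := id hij
    have hb : ∀ k ∈ S, i < k → k < j → VanishOn k j f :=
      fun k hk h1 h2 => absurd ⟨h1, h2⟩ (hadj k hk)
    obtain ⟨g, hg, hgd⟩ := lineSubst_factor (pairCoef i j) f (wheelRoots S i j)
      (fun t ht => by rw [(mem_wheelRoots.1 ht).2]; exact rootCoef_ne_zero _ _ _)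
      (wheelRoots_spec hi hj hlt hf hb)
    apply vanishOn_of_lineSubst hlt.ne
    have e1 := card_wheelRoots hi hj hlt.ne
    have e2 := card_erase_pair hi hj hlt.ne
    have e3 : (n + 1) * n = n * (n - 1) + 2 * n := by
      cases n with
      | zero => rfl
      | succ n => rw [Nat.add_sub_cancel]; ring
    -- the quotient has degree at most `n (n - 1)`, so it is constant in the variable of the line
    have hgm : ∀ m, m ≠ 0 → g.coeff m = 0 := by
      intro m hm0
      by_contra hm
      have := hgd m hm
      exact hm (noSmallWheel n ((S.erase i).erase j) _ (by omega) (hf.coeff hg m) (by omega))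
    have hg1 : g = Polynomial.C (g.coeff 0) := by
      ext1 m
      rw [Polynomial.coeff_C]
      split_ifs with h0
      · rw [h0]
      · exact hgm m h0
    have hg0 : g.coeff 0 = 0 := by
      by_contra hne
      have := hgd 0 hne
      refine hne (ih ((S.erase i).erase j) _ (by omega) (hf.coeff hg 0) (by omega) ?_)
      intro p hp
      have e4 := eval_lineSubst (pairCoef i j) f (matchingPoint p) q⁻¹
      have e5 : linePoint (pairCoef i j) (matchingPoint p) q⁻¹ =
          matchingPoint (fun k => if k = i then j else if k = j then i else p k) := by
        funext l
        by_cases c1 : l = i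
        · rw [c1, linePoint_pair_left]
          simp [matchingPoint, hlt]
        by_cases c2 : l = j
        · rw [c2, linePoint_pair_right hlt.ne]
          simp only [matchingPoint, if_neg hlt.ne', if_true, if_neg hlt.not_gt]
          field_simp
        · rw [linePoint_pair_other c1 c2]
          simp [matchingPoint, c1, c2]
      rw [e5, h _ (hp.extend hij), hg, Polynomial.map_mul, Polynomial.eval_mul] at e4
      have e6 := (mul_eq_zero.1 e4).resolve_left (rootProd_eval_ne_zero hij p)
      rw [hg1, Polynomial.map_C, Polynomial.eval_C] at e6
      exact e6
    rw [hg, hg1, hg0, map_zero, mul_zero]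

end Wheel

/-! ### The Hecke relations of the divided difference operators -/

section Operators

variable {N : ℕ}

/-- Polynomials are determined by their values at the points with pairwise distinct coordinates. -/
lemma ext_of_injective {f g : MvPolynomial (Fin N) K}
    (h : ∀ z : Fin N → K, Function.Injective z → eval z f = eval z g) : f = g := by
  have hne : ∏ x ∈ (Finset.univ : Finset (Fin N)).offDiag,
      (X x.1 - X x.2 : MvPolynomial (Fin N) K) ≠ 0 := by
    refine Finset.prod_ne_zero_iff.2 fun x hx h0 => ?_
    exact (Finset.mem_offDiag.1 hx).2.2 (X_injective (sub_eq_zero.1 h0))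
  refine sub_eq_zero.1 ((mul_eq_zero.1 (?_ : (f - g) * _ = 0)).resolve_right hne)
  apply MvPolynomial.funext
  intro z
  rw [map_mul, map_zero]
  by_cases hz : Function.Injective z
  · rw [map_sub, h z hz, sub_self, zero_mul]
  · simp only [Function.Injective] at hz
    push Not at hz
    obtain ⟨a, b, hab, hne⟩ := hz
    rw [map_prod, Finset.prod_eq_zero (i := (a, b)), mul_zero]
    · simp [hne]
    · simp [hab]

lemma eval_swapVars (a b : Fin N) (f : MvPolynomial (Fin N) K) (z : Fin N → K) :
    eval z (swapVars a b f) = eval (z ∘ Equiv.swap a b) f := by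
  rw [swapVars, eval_rename]

/-- The operator `𝐃_k`, with `a` and `b` for `k` and `k + 1`. -/
noncomputable def divOp (a b : Fin N) (f : MvPolynomial (Fin N) K) : MvPolynomial (Fin N) K :=
  (C q * X a - C q⁻¹ * X b) * divDiff a b f

lemma eval_divOp {a b : Fin N} {z : Fin N → K} (h : z a ≠ z b) (f : MvPolynomial (Fin N) K) :
    eval z (divOp a b f) = (q * z a - q⁻¹ * z b) / (z b - z a) *
      (eval (z ∘ Equiv.swap a b) f - eval z f) := by
  have h1 := congrArg (eval z) (divDiff_spec a b f)
  rw [map_mul, map_sub, map_sub, eval_swapVars, eval_X, eval_X] at h1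
  have h2 : z b - z a ≠ 0 := sub_ne_zero.2 h.symm
  rw [divOp, map_mul, ← h1]
  simp only [map_sub, map_mul, eval_C, eval_X]
  field_simp

lemma eval_divOp_eq_zero {a b : Fin N} {z : Fin N → K} (h : q * z a = q⁻¹ * z b)
    (f : MvPolynomial (Fin N) K) : eval z (divOp a b f) = 0 := by
  rw [divOp, map_mul]
  simp only [map_sub, map_mul, eval_C, eval_X]
  rw [h, sub_self, zero_mul]

lemma injective_comp_swap {z : Fin N → K} (hz : Function.Injective z) (a b : Fin N) :
    Function.Injective (z ∘ Equiv.swap a b) := hz.comp (Equiv.swap a b).injective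

lemma comp_swap_comp_swap (z : Fin N → K) (a b : Fin N) :
    (z ∘ Equiv.swap a b) ∘ Equiv.swap a b = z := by
  funext x
  simp

/-- The operator `𝐃_k` as a linear map. -/
noncomputable def divMap (a b : Fin N) (hab : a ≠ b) :
    MvPolynomial (Fin N) K →ₗ[K] MvPolynomial (Fin N) K where
  toFun := divOp a b
  map_add' f g := by
    apply ext_of_injective
    intro z hz
    simp only [eval_divOp (hz.ne hab), map_add]
    ring
  map_smul' c f := by
    apply ext_of_injective
    intro z hz
    simp only [eval_divOp (hz.ne hab), smul_eval, RingHom.id_apply]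
    ring

/-- The number `q + q⁻¹`. -/
noncomputable def loop : K := q + q⁻¹

lemma loop_ne_zero : loop ≠ 0 := by
  have hq := q_ne_zero
  intro h
  apply q_sq_ne_neg_one
  have : q * loop = q ^ 2 + 1 := by
    rw [loop]
    field_simp
  rw [h, mul_zero] at this
  linear_combination -this

lemma divMap_divMap {a b : Fin N} (hab : a ≠ b) (f : MvPolynomial (Fin N) K) :
    divMap a b hab (divMap a b hab f) = loop • divMap a b hab f := by
  have hq := q_ne_zero
  apply ext_of_injective
  intro z hz
  have h1 := sub_ne_zero.2 (hz.ne hab)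
  have h2 := sub_ne_zero.2 (hz.ne hab.symm)
  have h3 : (z ∘ Equiv.swap a b) a ≠ (z ∘ Equiv.swap a b) b := (injective_comp_swap hz a b).ne hab
  change eval z (divOp a b (divOp a b f)) = eval z (loop • divOp a b f)
  rw [smul_eval, eval_divOp (hz.ne hab), eval_divOp (hz.ne hab), eval_divOp h3,
    comp_swap_comp_swap]
  simp only [Function.comp_apply, Equiv.swap_apply_left, Equiv.swap_apply_right, loop]
  field_simp
  rw [show z b - z a = -(z a - z b) by ring]
  field_simp
  ring

lemma divMap_comm {a b c d : Fin N} (hab : a ≠ b) (hcd : c ≠ d) (hac : a ≠ c) (had : a ≠ d)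
    (hbc : b ≠ c) (hbd : b ≠ d) (f : MvPolynomial (Fin N) K) :
    divMap a b hab (divMap c d hcd f) = divMap c d hcd (divMap a b hab f) := by
  apply ext_of_injective
  intro z hz
  have h3 : (z ∘ Equiv.swap a b) c ≠ (z ∘ Equiv.swap a b) d := (injective_comp_swap hz a b).ne hcd
  have h4 : (z ∘ Equiv.swap c d) a ≠ (z ∘ Equiv.swap c d) b := (injective_comp_swap hz c d).ne hab
  have h5 : (z ∘ Equiv.swap a b) ∘ Equiv.swap c d = (z ∘ Equiv.swap c d) ∘ Equiv.swap a b := by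
    funext x
    simp only [Function.comp_apply, Equiv.swap_apply_def]
    grind
  change eval z (divOp a b (divOp c d f)) = eval z (divOp c d (divOp a b f))
  rw [eval_divOp (hz.ne hab), eval_divOp (hz.ne hcd), eval_divOp (hz.ne hcd),
    eval_divOp (hz.ne hab), eval_divOp h3, eval_divOp h4, h5]
  simp only [Function.comp_apply, Equiv.swap_apply_of_ne_of_ne hac.symm hbc.symm,
    Equiv.swap_apply_of_ne_of_ne had.symm hbd.symm, Equiv.swap_apply_of_ne_of_ne hac had,
    Equiv.swap_apply_of_ne_of_ne hbc hbd]
  ring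

/-- The braid relation. -/
lemma divMap_braid {a b c : Fin N} (hab : a ≠ b) (hbc : b ≠ c) (hac : a ≠ c)
    (f : MvPolynomial (Fin N) K) :
    divMap a b hab (divMap b c hbc (divMap a b hab f)) - divMap a b hab f =
      divMap b c hbc (divMap a b hab (divMap b c hbc f)) - divMap b c hbc f := by
  have hq := q_ne_zero
  apply ext_of_injective
  intro z hz
  have e1 : ∀ {z : Fin N → K}, Function.Injective z → ∀ g, eval z (divMap a b hab g) =
      (q * z a - q⁻¹ * z b) / (z b - z a) * (eval (z ∘ Equiv.swap a b) g - eval z g) :=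
    fun hz g => eval_divOp (hz.ne hab) g
  have e2 : ∀ {z : Fin N → K}, Function.Injective z → ∀ g, eval z (divMap b c hbc g) =
      (q * z b - q⁻¹ * z c) / (z c - z b) * (eval (z ∘ Equiv.swap b c) g - eval z g) :=
    fun hz g => eval_divOp (hz.ne hbc) g
  have i1 := injective_comp_swap hz a b
  have i2 := injective_comp_swap hz b c
  have i3 := injective_comp_swap i1 b c
  have i4 := injective_comp_swap i2 a b
  have h5 : ((z ∘ Equiv.swap a b) ∘ Equiv.swap b c) ∘ Equiv.swap a b =
      ((z ∘ Equiv.swap b c) ∘ Equiv.swap a b) ∘ Equiv.swap b c := by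
    funext x
    simp only [Function.comp_apply, Equiv.swap_apply_def]
    grind
  simp only [map_sub, e1 hz, e2 hz, e1 i1, e2 i1, e1 i2, e2 i2, e1 i3, e2 i4, h5,
    comp_swap_comp_swap]
  simp only [Function.comp_apply, Equiv.swap_apply_left, Equiv.swap_apply_right,
    Equiv.swap_apply_of_ne_of_ne hac.symm hbc.symm,
    Equiv.swap_apply_of_ne_of_ne hab hac]
  have n1 : z b - z a ≠ 0 := sub_ne_zero.2 (hz.ne hab.symm)
  have n2 : z c - z a ≠ 0 := sub_ne_zero.2 (hz.ne hac.symm)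
  have n3 : z c - z b ≠ 0 := sub_ne_zero.2 (hz.ne hbc.symm)
  rw [show z a - z b = -(z b - z a) by ring, show z b - z c = -(z c - z b) by ring]
  generalize eval z f = f0
  generalize eval (z ∘ Equiv.swap a b) f = f1
  generalize eval (z ∘ Equiv.swap b c) f = f2
  generalize eval ((z ∘ Equiv.swap a b) ∘ Equiv.swap b c) f = f3
  generalize eval ((z ∘ Equiv.swap b c) ∘ Equiv.swap a b) f = f4
  generalize eval (((z ∘ Equiv.swap b c) ∘ Equiv.swap a b) ∘ Equiv.swap b c) f = f5
  field_simp
  ring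

lemma swap_eval_of_divMap_eq_zero {a b : Fin N} (hab : a ≠ b) {f : MvPolynomial (Fin N) K}
    (h : divMap a b hab f = 0) (z : Fin N → K) : eval (z ∘ Equiv.swap a b) f = eval z f := by
  have hq := q_ne_zero
  have h1 : (C q * X a - C q⁻¹ * X b : MvPolynomial (Fin N) K) ≠ 0 := by
    intro h0
    have := C_mul_X_inj hq (sub_eq_zero.1 h0)
    exact hab (Prod.mk.inj this).2
  have h2 := divDiff_spec a b f
  rw [(mul_eq_zero.1 (h : divOp a b f = 0)).resolve_left h1, mul_zero] at h2
  rw [← eval_swapVars, ← sub_eq_zero, ← map_sub, ← h2, map_zero]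

/-! ### The operators preserve the wheel polynomials -/

lemma isHomogeneous_mul_of_isHomogeneous_mul {R : Type*} [CommRing R] [IsDomain R] {σ : Type*}
    {L L' g : MvPolynomial σ R} {d : ℕ} (hL : L.IsHomogeneous 1) (hL' : L'.IsHomogeneous 1)
    (h0 : L ≠ 0) (h : (L * g).IsHomogeneous d) : (L' * g).IsHomogeneous d := by
  classical
  let _ : GradedAlgebra (homogeneousSubmodule σ R) := gradedAlgebra
  have hz : ∀ j, 1 + j ≠ d → homogeneousComponent j g = 0 := by
    intro j hj
    have h1 := DirectSum.coe_decompose_mul_add_of_left_mem (homogeneousSubmodule σ R)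
      (i := 1) (j := j) (b := g) ((mem_homogeneousSubmodule 1 L).2 hL)
    have h2 : ((DirectSum.decompose (homogeneousSubmodule σ R) (L * g)) (1 + j) :
        MvPolynomial σ R) = 0 :=
      DirectSum.decompose_of_mem_ne _ ((mem_homogeneousSubmodule d _).2 h) (Ne.symm hj)
    rw [h2] at h1
    have h3 := (mul_eq_zero.1 h1.symm).resolve_left h0
    exact (decomposition.decompose'_apply g j).symm.trans h3
  rw [← sum_homogeneousComponent g, Finset.mul_sum]
  refine IsHomogeneous.sum _ _ _ fun j _ => ?_
  by_cases hj : 1 + j = d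
  · rw [← hj]
    exact hL'.mul (homogeneousComponent_isHomogeneous j g)
  · rw [hz j hj, mul_zero]
    exact isHomogeneous_zero _ _ _

lemma divMap_isHomogeneous {a b : Fin N} (hab : a ≠ b) {d : ℕ} {f : MvPolynomial (Fin N) K}
    (hf : f.IsHomogeneous d) : (divMap a b hab f).IsHomogeneous d := by
  refine isHomogeneous_mul_of_isHomogeneous_mul (L := X b - X a) ?_ ?_ ?_ ?_
  · exact (isHomogeneous_X _ _).sub (isHomogeneous_X _ _)
  · exact (isHomogeneous_C_mul_X _ _).sub (isHomogeneous_C_mul_X _ _)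
  · exact sub_ne_zero.2 fun h => hab (X_injective h).symm
  · rw [divDiff_spec]
    exact (hf.rename_isHomogeneous).sub hf

end Operators

section WheelSpace

variable {n : ℕ}

lemma eval_wheelSubst (i j k : Fin (2 * n)) (p : Poly n) (z : Fin (2 * n) → K) :
    eval z (wheelSubst i j k p) = eval (fun m => if m = j then q ^ 2 * z i else if m = k then
      q ^ 4 * z i else z m) p := by
  have h : (aeval z : Poly n →ₐ[K] K).comp (wheelSubst i j k) =
      aeval (fun m => if m = j then q ^ 2 * z i else if m = k then q ^ 4 * z i else z m) := by
    apply MvPolynomial.algHom_ext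
    intro m
    simp only [wheelSubst, AlgHom.comp_apply, aeval_X]
    split_ifs <;> simp
  exact DFunLike.congr_fun h p

lemma mem_W_iff (p : Poly n) :
    p ∈ W n ↔ p.IsHomogeneous (n * (n - 1)) ∧ WheelOn Finset.univ p := by
  rw [mem_W]
  refine and_congr_right fun _ => ⟨?_, ?_⟩
  · intro h i _ j _ k _ hij hjk z hj hk
    have h1 := eval_wheelSubst i j k p z
    rw [h i j k hij hjk, map_zero] at h1
    rw [h1]
    congr 2
    funext m
    split_ifs with c1 c2
    · rw [c1, hj]
    · rw [c2, hk]
    · rfl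
  · intro h i j k hij hjk
    apply MvPolynomial.funext
    intro z
    rw [eval_wheelSubst, map_zero]
    have := hij.trans hjk
    refine h i (Finset.mem_univ _) j (Finset.mem_univ _) k (Finset.mem_univ _) hij hjk _ ?_ ?_
    · simp [hij.ne, this.ne]
    · simp [hij.ne, this.ne, hjk.ne']

lemma wheelSubst_X_ne {i j k : Fin (2 * n)} {a b : Fin (2 * n)} (hab : a ≠ b) :
    wheelSubst i j k (X b - X a) ≠ 0 := by
  have hq := q_ne_zero
  let c : Fin (2 * n) → K := fun m => if m = j then q ^ 2 else if m = k then q ^ 4 else 1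
  let v : Fin (2 * n) → Fin (2 * n) := fun m => if m = j then i else if m = k then i else m
  have hX : ∀ m, wheelSubst i j k (X m) = C (c m) * X (v m) := by
    intro m
    simp only [wheelSubst, aeval_X, c, v]
    split_ifs <;> simp
  have hc : ∀ m, c m ≠ 0 := by
    intro m
    simp only [c]
    split_ifs <;> simp [hq]
  rw [map_sub, hX, hX, sub_ne_zero]
  intro h
  have h1 := Prod.mk.inj (C_mul_X_inj (hc b) h)
  have q2 := q_pow_ne_one (m := 2) (by norm_num)
  have q4 := q_pow_ne_one (m := 4) (by norm_num)
  have q24 : q ^ 2 ≠ q ^ 4 := by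
    intro h
    apply q2
    have h2 : q ^ 2 * q ^ 2 = q ^ 2 * 1 := by rw [mul_one]; nth_rewrite 3 [h]; ring
    exact mul_left_cancel₀ (pow_ne_zero 2 hq) h2
  simp only [c, v] at h1
  generalize q ^ 2 = x at *
  generalize q ^ 4 = y at *
  grind

lemma wheelSubst_prefactor_left {i j k : Fin (2 * n)} (hij : i < j) (hjk : j < k) :
    wheelSubst i j k (C q * X i - C q⁻¹ * X j) = 0 := by
  have hq := q_ne_zero
  apply MvPolynomial.funext
  intro z
  rw [eval_wheelSubst]
  simp only [map_sub, map_mul, eval_C, eval_X, if_true, if_neg hij.ne, if_neg (hij.trans hjk).ne,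
    map_zero]
  field_simp
  ring

lemma wheelSubst_prefactor_right {i j k : Fin (2 * n)} (hjk : j < k) :
    wheelSubst i j k (C q * X j - C q⁻¹ * X k) = 0 := by
  have hq := q_ne_zero
  apply MvPolynomial.funext
  intro z
  rw [eval_wheelSubst]
  simp only [map_sub, map_mul, eval_C, eval_X, if_true, if_neg hjk.ne', map_zero]
  field_simp
  ring

/-- Unless both of the points `a` and `b = a + 1` belong to the triple `i < j < k`, exchanging them
preserves the order of the triple. -/
lemma swap_lt_swap {a b i j : Fin (2 * n)} (hab : b.val = a.val + 1) (hij : i < j)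
    (h : ¬ (i = a ∧ j = b)) : Equiv.swap a b i < Equiv.swap a b j := by
  simp only [Equiv.swap_apply_def, Fin.ext_iff, Fin.lt_def] at *
  split_ifs <;> omega

lemma wheelSubst_swapVars {a b : Fin (2 * n)} (hab : b.val = a.val + 1) {f : Poly n}
    (hf : WheelOn Finset.univ f) {i j k : Fin (2 * n)} (hij : i < j) (hjk : j < k)
    (c1 : ¬ (i = a ∧ j = b)) (c2 : ¬ (j = a ∧ k = b)) :
    wheelSubst i j k (swapVars a b f) = 0 := by
  apply MvPolynomial.funext
  intro z
  rw [eval_wheelSubst, eval_swapVars, map_zero]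
  have hik := hij.trans hjk
  refine hf _ (Finset.mem_univ (Equiv.swap a b i)) _ (Finset.mem_univ (Equiv.swap a b j)) _
    (Finset.mem_univ (Equiv.swap a b k)) (swap_lt_swap hab hij c1) (swap_lt_swap hab hjk c2) _ ?_ ?_
  · simp [hij.ne, hik.ne]
  · simp [hij.ne, hik.ne, hjk.ne']

lemma divMap_mem_W {a b : Fin (2 * n)} (hab : b.val = a.val + 1) (hne : a ≠ b) {f : Poly n}
    (hf : f ∈ W n) : divMap a b hne f ∈ W n := by
  obtain ⟨hh, hw⟩ := (mem_W_iff f).1 hf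
  rw [mem_W]
  refine ⟨divMap_isHomogeneous hne hh, fun i j k hij hjk => ?_⟩
  have e : divMap a b hne f = (C q * X a - C q⁻¹ * X b) * divDiff a b f := rfl
  rw [e, map_mul]
  by_cases c1 : i = a ∧ j = b
  · rw [← c1.1, ← c1.2, wheelSubst_prefactor_left hij hjk, zero_mul]
  by_cases c2 : j = a ∧ k = b
  · rw [← c2.1, ← c2.2, wheelSubst_prefactor_right hjk, zero_mul]
  have h1 := congrArg (wheelSubst i j k) (divDiff_spec a b f)
  rw [map_mul, map_sub _ (swapVars a b f) f, ((mem_W f).1 hf).2 i j k hij hjk, sub_zero,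
    wheelSubst_swapVars hab hw hij hjk c1 c2] at h1
  rw [(mul_eq_zero.1 h1).resolve_left (wheelSubst_X_ne hne), mul_zero]

/-- A wheel polynomial that is symmetric in three consecutive variables is zero. -/
lemma eq_zero_of_symmetric {f : Poly n} (hf : f ∈ W n) {a b c : Fin (2 * n)}
    (hab : b.val = a.val + 1) (hbc : c.val = b.val + 1)
    (h1 : ∀ z, eval (z ∘ Equiv.swap a b) f = eval z f)
    (h2 : ∀ z, eval (z ∘ Equiv.swap b c) f = eval z f) : f = 0 := by
  have hq := q_ne_zero
  have lab : a < b := by rw [Fin.lt_def]; omega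
  have lbc : b < c := by rw [Fin.lt_def]; omega
  have lac := lab.trans lbc
  obtain ⟨m, rfl⟩ : ∃ m, n = m + 1 := ⟨n - 1, by have := a.2; omega⟩
  obtain ⟨hh, hw⟩ := (mem_W_iff f).1 hf
  have hd := hh.totalDegree_le
  rw [Nat.add_sub_cancel] at hd
  have hadj : ∀ k ∈ Finset.univ, ¬ (a < k ∧ k < b) := by
    intro k _
    simp only [Fin.lt_def]
    omega
  have hN : Neighbors Finset.univ a b := ⟨Finset.mem_univ _, Finset.mem_univ _, lab, hadj⟩
  have v1 : VanishOn a b f := by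
    refine vanishOn_of_extra_root (noSmallWheel m) (by simp) hw hd (Finset.mem_univ _)
      (Finset.mem_univ _) lab (fun k hk h1 h2 => absurd ⟨h1, h2⟩ (hadj k hk)) (q ^ 2) c
      (pow_ne_zero 2 hq) ?_ ?_
    · rw [rootCoef, if_neg lac.not_gt, if_pos lbc]
      intro h
      refine q_pow_ne_one (m := 6) (by norm_num) ?_
      rw [show q ^ 6 = q ^ 2 * q ^ 4 by ring, h]
      exact inv_mul_cancel₀ (pow_ne_zero 4 hq)
    · intro z
      rw [← h2, ← h1]
      refine hw a (Finset.mem_univ _) b (Finset.mem_univ _) c (Finset.mem_univ _) lab lbc _ ?_ ?_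
      · simp only [Function.comp_apply, Equiv.swap_apply_left, Equiv.swap_apply_right,
          Equiv.swap_apply_of_ne_of_ne lab.ne lac.ne, linePoint_pair_left,
          linePoint_pair_other lac.ne' lbc.ne']
      · simp only [Function.comp_apply, Equiv.swap_apply_left, Equiv.swap_apply_right,
          Equiv.swap_apply_of_ne_of_ne lac.ne' lbc.ne', linePoint_pair_right lab.ne,
          linePoint_pair_other lac.ne' lbc.ne']
        ring
  refine eq_zero_of_vanishOn_both (m + 1) Finset.univ f (by simp) hw hh.totalDegree_le a b hN v1 ?_
  intro z hz
  rw [← h1]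
  apply v1
  simp [hz]

end WheelSpace

/-! ### The Temperley-Lieb relations on the wheel polynomials -/

section TemperleyLieb

variable {N : ℕ}

/-- The Temperley-Lieb generator `𝐃_k - (q + q⁻¹)`. -/
noncomputable def tlMap (a b : Fin N) (hab : a ≠ b) :
    MvPolynomial (Fin N) K →ₗ[K] MvPolynomial (Fin N) K :=
  divMap a b hab - loop • LinearMap.id

lemma tlMap_apply {a b : Fin N} (hab : a ≠ b) (f : MvPolynomial (Fin N) K) :
    tlMap a b hab f = divMap a b hab f - loop • f := rfl

lemma divMap_tlMap {a b : Fin N} (hab : a ≠ b) (f : MvPolynomial (Fin N) K) :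
    divMap a b hab (tlMap a b hab f) = 0 := by
  rw [tlMap_apply, map_sub, map_smul, divMap_divMap, sub_self]

lemma tlMap_comm {a b c d : Fin N} (hab : a ≠ b) (hcd : c ≠ d) (hac : a ≠ c) (had : a ≠ d)
    (hbc : b ≠ c) (hbd : b ≠ d) (f : MvPolynomial (Fin N) K) :
    tlMap a b hab (tlMap c d hcd f) = tlMap c d hcd (tlMap a b hab f) := by
  simp only [tlMap_apply, map_sub, map_smul, divMap_comm hab hcd hac had hbc hbd, smul_sub]
  abel

lemma tlMap_braid {a b c : Fin N} (hab : a ≠ b) (hbc : b ≠ c) (hac : a ≠ c)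
    (f : MvPolynomial (Fin N) K) :
    tlMap a b hab (tlMap b c hbc (tlMap a b hab f)) - tlMap a b hab f =
      tlMap b c hbc (tlMap a b hab (tlMap b c hbc f)) - tlMap b c hbc f := by
  have h := divMap_braid hab hbc hac f
  rw [← sub_eq_zero] at h ⊢
  refine Eq.trans ?_ h
  simp only [tlMap_apply, map_sub, map_smul, divMap_divMap, smul_sub]
  abel

variable {n : ℕ}

lemma tlMap_mem_W {a b : Fin (2 * n)} (hab : b.val = a.val + 1) (hne : a ≠ b) {f : Poly n}
    (hf : f ∈ W n) : tlMap a b hne f ∈ W n := by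
  rw [tlMap_apply]
  exact (W n).sub_mem (divMap_mem_W hab hne hf) ((W n).smul_mem _ hf)

/-- The difference of the two sides is annihilated by both of the operators `𝐃_k`, so it is
symmetric in three consecutive variables. -/
lemma tlMap_tlMap_tlMap {a b c : Fin (2 * n)} (hab : b.val = a.val + 1) (hbc : c.val = b.val + 1)
    (nab : a ≠ b) (nbc : b ≠ c) {f : Poly n} (hf : f ∈ W n) :
    tlMap a b nab (tlMap b c nbc (tlMap a b nab f)) = tlMap a b nab f ∧
      tlMap b c nbc (tlMap a b nab (tlMap b c nbc f)) = tlMap b c nbc f := by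
  have nac : a ≠ c := by
    rw [Ne, Fin.ext_iff]
    omega
  have h := tlMap_braid nab nbc nac f
  have hW := tlMap_mem_W hab nab hf
  have hX : tlMap a b nab (tlMap b c nbc (tlMap a b nab f)) - tlMap a b nab f = 0 := by
    refine eq_zero_of_symmetric ?_ hab hbc (swap_eval_of_divMap_eq_zero nab ?_)
      (swap_eval_of_divMap_eq_zero nbc ?_)
    · exact (W n).sub_mem (tlMap_mem_W hab nab (tlMap_mem_W hbc nbc hW)) hW
    · rw [map_sub, divMap_tlMap, divMap_tlMap, sub_self]
    · rw [h, map_sub, divMap_tlMap, divMap_tlMap, sub_self]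
  exact ⟨sub_eq_zero.1 hX, sub_eq_zero.1 (h ▸ hX)⟩

end TemperleyLieb

/-! ### Separation of wheel polynomials by values, and the values of `Ψ_{()_n}` -/

section Psi0

variable {n : ℕ}

/-- The point at which the left-endpoints of `π` have the coordinate `q⁻¹` and the right-endpoints
the coordinate `q`. -/
noncomputable def NCMatching.point (π : NCMatching n) : Fin (2 * n) → K := matchingPoint π.partner

lemma NCMatching.point_left {π : NCMatching n} {i : Fin (2 * n)} (h : i < π.partner i) :
    π.point i = q⁻¹ := if_pos h

lemma NCMatching.point_right {π : NCMatching n} {i : Fin (2 * n)} (h : ¬ i < π.partner i) :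
    π.point i = q := if_neg h

/-- A wheel polynomial is determined by its values at the points of the noncrossing matchings. -/
lemma eq_zero_of_points {f : Poly n} (hf : f ∈ W n)
    (h : ∀ π : NCMatching n, eval π.point f = 0) : f = 0 := by
  obtain ⟨hh, hw⟩ := (mem_W_iff f).1 hf
  refine eq_zero_of_matchingPoints n Finset.univ f (by simp) hw hh.totalDegree_le fun p hp => ?_
  exact h ⟨p, fun i => (hp.1 i (Finset.mem_univ _)).2.1, fun i => (hp.1 i (Finset.mem_univ _)).2.2,
    fun a b => hp.2 a (Finset.mem_univ _) b (Finset.mem_univ _)⟩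

variable [NeZero n]

lemma Psi0_mem_W : Psi0 n ∈ W n := by
  have hq := q_ne_zero
  rw [mem_W]
  have hlin : ∀ a b : Fin (2 * n), (C q * X a - C q⁻¹ * X b : Poly n).IsHomogeneous 1 :=
    fun a b => (isHomogeneous_C_mul_X _ _).sub (isHomogeneous_C_mul_X _ _)
  constructor
  · have h1 := IsHomogeneous.prod (Finset.Icc 1 n) (fun i => ∏ j ∈ Finset.Ioc i n,
      ((C q * X (pt n i) - C q⁻¹ * X (pt n j)) *
        (C q * X (pt n (n + i)) - C q⁻¹ * X (pt n (n + j))) : Poly n))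
      (fun i => ∑ j ∈ Finset.Ioc i n, (1 + 1))
      (fun i _ => IsHomogeneous.prod _ _ _ (fun j _ => (hlin _ _).mul (hlin _ _)))
    have h2 : ∑ i ∈ Finset.Icc 1 n, ∑ j ∈ Finset.Ioc i n, (1 + 1) = n * (n - 1) := by
      simp only [Finset.sum_const, Nat.card_Ioc, smul_eq_mul]
      rw [← Finset.sum_mul]
      have h3 : ∑ i ∈ Finset.Icc 1 n, (n - i) = ∑ i ∈ Finset.range n, i := by
        rw [← Finset.sum_range_reflect, Finset.range_eq_Ico,
          Finset.sum_Ico_eq_sum_range, ← Finset.Ico_add_one_right_eq_Icc,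
          Finset.sum_Ico_eq_sum_range]
        refine Finset.sum_congr (by simp) fun i hi => ?_
        omega
      rw [h3, one_add_one_eq_two, Finset.sum_range_id_mul_two]
    rw [h2] at h1
    exact h1.C_mul _
  · intro i j k hij hjk
    rw [Psi0, map_mul]
    refine mul_eq_zero_of_right _ ?_
    have hi : pt n (i.val + 1) = i := Fin.ext (by rw [pt_val] <;> omega)
    have hj : pt n (j.val + 1) = j := Fin.ext (by rw [pt_val] <;> omega)
    have hk : pt n (k.val + 1) = k := Fin.ext (by rw [pt_val] <;> omega)
    simp only [Fin.lt_def] at hij hjk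
    rw [map_prod]
    by_cases c : j.val < n
    · refine Finset.prod_eq_zero (i := i.val + 1) (by simp; omega) ?_
      rw [map_prod]
      refine Finset.prod_eq_zero (i := j.val + 1) (by simp; omega) ?_
      rw [map_mul, hi, hj, wheelSubst_prefactor_left hij hjk, zero_mul]
    · refine Finset.prod_eq_zero (i := j.val + 1 - n) (by simp; omega) ?_
      rw [map_prod]
      refine Finset.prod_eq_zero (i := k.val + 1 - n) (by simp; omega) ?_
      rw [map_mul, show n + (j.val + 1 - n) = j.val + 1 by omega,
        show n + (k.val + 1 - n) = k.val + 1 by omega, hj, hk,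
        wheelSubst_prefactor_right hjk, mul_zero]

lemma eval_Psi0 (z : Fin (2 * n) → K) : eval z (Psi0 n) = ((q - q⁻¹) ^ (n * (n - 1)))⁻¹ *
    ∏ i ∈ Finset.Icc 1 n, ∏ j ∈ Finset.Ioc i n, (q * z (pt n i) - q⁻¹ * z (pt n j)) *
      (q * z (pt n (n + i)) - q⁻¹ * z (pt n (n + j))) := by
  simp [Psi0, map_prod]

lemma q_sub_inv_ne_zero : q - q⁻¹ ≠ 0 := by
  have hq := q_ne_zero
  intro h
  apply q_pow_ne_one (m := 2) (by norm_num)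
  have : q * (q - q⁻¹) = q ^ 2 - 1 := by field_simp
  rw [h, mul_zero] at this
  linear_combination -this

lemma eval_nested_Psi0_ne_zero : eval (NCMatching.nested n).point (Psi0 n) ≠ 0 := by
  have hq := q_ne_zero
  have hne := q_sub_inv_ne_zero
  have hl : ∀ i, 1 ≤ i → i ≤ n → (NCMatching.nested n).point (pt n i) = q⁻¹ := by
    intro i h1 h2
    apply NCMatching.point_left
    rw [NCMatching.nested, Fin.lt_def, Fin.val_rev, pt_val n i h1 (by omega)]
    omega
  have hr : ∀ i, 1 ≤ i → i ≤ n → (NCMatching.nested n).point (pt n (n + i)) = q := by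
    intro i h1 h2
    apply NCMatching.point_right
    rw [NCMatching.nested, Fin.lt_def, Fin.val_rev, pt_val n (n + i) (by omega) (by omega)]
    omega
  rw [eval_Psi0]
  refine mul_ne_zero (inv_ne_zero (pow_ne_zero _ hne)) ?_
  refine Finset.prod_ne_zero_iff.2 fun i hi => Finset.prod_ne_zero_iff.2 fun j hj => ?_
  rw [Finset.mem_Icc] at hi
  rw [Finset.mem_Ioc] at hj
  rw [hl i hi.1 hi.2, hl j (by omega) hj.2, hr i hi.1 hi.2, hr j (by omega) hj.2]
  refine mul_ne_zero ?_ ?_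
  · rw [← sub_mul]
    exact mul_ne_zero hne (inv_ne_zero hq)
  · rw [← sub_mul]
    exact mul_ne_zero hne hq

/-- A matching other than `()_n` has a right-endpoint among the first `n` points, and the first
point is a left-endpoint. -/
lemma eval_Psi0_eq_zero {π : NCMatching n} (hπ : π ≠ NCMatching.nested n) :
    eval π.point (Psi0 n) = 0 := by
  have hq := q_ne_zero
  have hn := NeZero.pos n
  have hex : ∃ r : Fin (2 * n), r.val < n ∧ ¬ r < π.partner r := by
    by_contra hcon
    push Not at hcon
    apply hπ
    have hsub : Finset.univ.filter (fun k : Fin (2 * n) => k.val < n) =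
        Finset.univ.filter (fun k => k < π.partner k) := by
      apply Finset.eq_of_subset_of_card_le
      · intro k hk
        simp only [Finset.mem_filter, Finset.mem_univ, true_and] at hk ⊢
        exact hcon k hk
      · rw [π.card_left]
        have : Finset.univ.filter (fun k : Fin (2 * n) => k.val < n) =
            Finset.Iio (⟨n, by omega⟩ : Fin (2 * n)) := by
          ext k
          simp [Fin.lt_def]
        rw [this, Fin.card_Iio]
    apply NCMatching.ext_left
    intro i
    have h1 := Finset.ext_iff.1 hsub i
    simp only [Finset.mem_filter, Finset.mem_univ, true_and] at h1
    rw [← h1, NCMatching.nested, Fin.lt_def, Fin.val_rev]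
    omega
  obtain ⟨r, hr, hr'⟩ := hex
  have hl : (⟨0, by omega⟩ : Fin (2 * n)) < π.partner ⟨0, by omega⟩ := by
    have := π.partner_ne ⟨0, by omega⟩
    rw [Ne, Fin.ext_iff] at this
    rw [Fin.lt_def]
    exact Nat.pos_of_ne_zero this
  have hr0 : r.val ≠ 0 := by
    intro h0
    have : r = ⟨0, by omega⟩ := Fin.ext h0
    rw [this] at hr'
    exact hr' hl
  have p1 : pt n 1 = ⟨0, by omega⟩ := Fin.ext (by rw [pt_val] <;> omega)
  have p2 : pt n (r.val + 1) = r := Fin.ext (by rw [pt_val] <;> omega)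
  rw [eval_Psi0]
  refine mul_eq_zero_of_right _ ?_
  refine Finset.prod_eq_zero (i := 1) (by simp; omega) ?_
  refine Finset.prod_eq_zero (i := r.val + 1)
    (Finset.mem_Ioc.2 ⟨by omega, by omega⟩) ?_
  rw [p1, p2, NCMatching.point_left hl, NCMatching.point_right hr', mul_inv_cancel₀ hq,
    inv_mul_cancel₀ hq, sub_self, zero_mul]

end Psi0

/-! ### Lattice paths -/

namespace NCMatching

variable {n : ℕ}

/-- The number of left-endpoints among the first `d` points. -/
def lefts (π : NCMatching n) (d : ℕ) : ℕ :=
  (Finset.univ.filter (fun k : Fin (2 * n) => k.val < d ∧ k < π.partner k)).card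

lemma lefts_succ (π : NCMatching n) (i : Fin (2 * n)) :
    π.lefts (i.val + 1) = π.lefts i.val + if i < π.partner i then 1 else 0 := by
  unfold lefts
  split_ifs with h
  · have : (Finset.univ.filter (fun k : Fin (2 * n) => k.val < i.val + 1 ∧ k < π.partner k)) =
        insert i (Finset.univ.filter (fun k : Fin (2 * n) => k.val < i.val ∧ k < π.partner k)) := by
      ext k
      simp only [Finset.mem_filter, Finset.mem_univ, true_and, Finset.mem_insert]
      rcases eq_or_ne k i with rfl | hk
      · simp [h]
      · have := Fin.val_ne_of_ne hk
        simp only [hk, false_or, and_congr_left_iff]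
        omega
    rw [this, Finset.card_insert_of_notMem (by simp)]
  · rw [add_zero]
    congr 1
    ext k
    simp only [Finset.mem_filter, Finset.mem_univ, true_and, and_congr_left_iff]
    intro hk
    have : k ≠ i := by
      rintro rfl
      exact h hk
    have := Fin.val_ne_of_ne this
    omega

lemma lefts_of_le (π : NCMatching n) {d : ℕ} (hd : 2 * n ≤ d) : π.lefts d = n := by
  conv_rhs => rw [← π.card_left]
  unfold lefts
  congr 1
  ext k
  have := k.2
  simp only [Finset.mem_filter, Finset.mem_univ, true_and, and_iff_right_iff_imp]
  omega

lemma lefts_mono (π : NCMatching n) {d e : ℕ} (h : d ≤ e) : π.lefts d ≤ π.lefts e := by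
  apply Finset.card_le_card
  intro k hk
  simp only [Finset.mem_filter, Finset.mem_univ, true_and] at hk ⊢
  exact ⟨by omega, hk.2⟩

lemma lefts_add_le (π : NCMatching n) (d e : ℕ) : π.lefts (d + e) ≤ π.lefts d + e := by
  induction e with
  | zero => exact le_rfl
  | succ e ih =>
    by_cases h : d + e < 2 * n
    · have := π.lefts_succ ⟨d + e, h⟩
      dsimp only at this
      rw [← add_assoc, this]
      split_ifs <;> omega
    · rw [lefts_of_le π (by omega)] at ih ⊢
      omega

lemma lefts_zero (π : NCMatching n) : π.lefts 0 = 0 := by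
  simp [lefts]

/-- The right-endpoints among the first `d` points are the others. -/
lemma card_rights (π : NCMatching n) {d : ℕ} (hd : d ≤ 2 * n) :
    (Finset.univ.filter (fun k : Fin (2 * n) => k.val < d ∧ ¬ k < π.partner k)).card +
      π.lefts d = d := by
  have h := Finset.card_filter_add_card_filter_not
    (s := (Finset.univ.filter (fun k : Fin (2 * n) => k.val < d))) (fun k => k < π.partner k)
  rw [Finset.filter_filter, Finset.filter_filter] at h
  have h2 : (Finset.univ.filter (fun k : Fin (2 * n) => k.val < d)).card = d := by
    rw [Fin.card_filter_val_lt]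
    omega
  rw [h2] at h
  unfold lefts
  omega

/-- Among the first `d` points there are at least as many left-endpoints as right-endpoints. -/
lemma le_two_mul_lefts (π : NCMatching n) {d : ℕ} (hd : d ≤ 2 * n) : d ≤ 2 * π.lefts d := by
  have h := π.card_rights hd
  have h2 : (Finset.univ.filter (fun k : Fin (2 * n) => k.val < d ∧ ¬ k < π.partner k)).card ≤
      π.lefts d := by
    refine Finset.card_le_card_of_injOn π.partner ?_ ?_
    · intro k hk
      simp only [Finset.coe_filter, Finset.mem_univ, true_and, Set.mem_ofPred_eq] at hk ⊢
      have h1 := (π.right_iff k).2 hk.2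
      rw [π.partner_partner]
      exact ⟨(Fin.lt_def.1 h1).trans hk.1, h1⟩
    · intro k _ l _ h
      rw [← π.partner_partner k, h, π.partner_partner]
  omega

/-- A box belongs to the Young diagram iff the lattice path passes below it on its diagonal. -/
lemma mem_young_iff (π : NCMatching n) (r c : ℕ) : (r, c) ∈ π.young.cells ↔
    r < n ∧ c < n ∧ π.lefts (n + c - r) ≤ n - 1 - r := by
  rw [mem_young, rowLen_eq]
  by_cases hr : r < n
  swap
  · have : π.low (n - r) = ∅ := by
      ext i
      rw [mem_low]
      simp only [Finset.notMem_empty, iff_false]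
      omega
    rw [this, Finset.card_empty]
    omega
  have hlow : ∀ i, i ∈ π.low (n - r) ↔ ¬ i < π.partner i ∧ π.lefts i.val < n - r := by
    intro i
    rw [mem_low, right_iff]
    rfl
  by_cases hc : c < n
  swap
  · have h1 := π.card_rights le_rfl
    rw [π.lefts_of_le le_rfl] at h1
    have h2 : (π.low (n - r)).card ≤ (Finset.univ.filter
        (fun k : Fin (2 * n) => k.val < 2 * n ∧ ¬ k < π.partner k)).card := by
      apply Finset.card_le_card
      intro i hi
      simp only [Finset.mem_filter, Finset.mem_univ, true_and]
      exact ⟨i.2, ((hlow i).1 hi).1⟩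
    omega
  have hR := π.card_rights (d := n + c - r) (by omega)
  constructor
  · intro h
    refine ⟨hr, hc, ?_⟩
    by_contra hcon
    have h2 : (π.low (n - r)).card ≤ (Finset.univ.filter
        (fun k : Fin (2 * n) => k.val < n + c - r ∧ ¬ k < π.partner k)).card := by
      apply Finset.card_le_card
      intro i hi
      have h3 := (hlow i).1 hi
      simp only [Finset.mem_filter, Finset.mem_univ, true_and]
      refine ⟨?_, h3.1⟩
      by_contra h4
      have := π.lefts_mono (not_lt.1 h4)
      omega
    omega
  · rintro ⟨-, -, h⟩
    have h2 : (Finset.univ.filter (fun k : Fin (2 * n) => k.val < n + c - r ∧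
        ¬ k < π.partner k)).card ≤ (π.low (n - r)).card := by
      apply Finset.card_le_card
      intro i hi
      simp only [Finset.mem_filter, Finset.mem_univ, true_and] at hi
      rw [hlow]
      have := π.lefts_mono hi.1.le
      exact ⟨hi.2, by omega⟩
    omega

/-- The boxes on one diagonal determine the height of the path on this diagonal. -/
lemma lefts_le_of_diagonal {σ π : NCMatching n} (d : ℕ)
    (h : ∀ r c, r < n → n + c - r = d → (r, c) ∈ σ.young.cells → (r, c) ∈ π.young.cells) :
    π.lefts d ≤ σ.lefts d := by
  by_cases hd : 2 * n ≤ d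
  · rw [lefts_of_le _ hd, lefts_of_le _ hd]
  by_contra hcon
  have h1 := π.lefts_add_le 0 d
  rw [zero_add, lefts_zero] at h1
  have h2 := π.lefts_mono (le_of_not_ge hd)
  rw [lefts_of_le _ le_rfl] at h2
  have h3 := σ.lefts_add_le d (2 * n - d)
  rw [lefts_of_le _ (by omega)] at h3
  have h4 := h (n - 1 - σ.lefts d) (d - 1 - σ.lefts d) (by omega) (by omega)
  rw [mem_young_iff, mem_young_iff,
    show n + (d - 1 - σ.lefts d) - (n - 1 - σ.lefts d) = d by omega] at h4
  have := (h4 ⟨by omega, by omega, by omega⟩).2.2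
  omega

lemma le_iff_lefts {σ π : NCMatching n} : σ ≤ π ↔ ∀ d, π.lefts d ≤ σ.lefts d := by
  constructor
  · intro h d
    exact lefts_le_of_diagonal d fun r c _ _ hx => h hx
  · rintro h ⟨r, c⟩ hx
    have h1 := (σ.mem_young_iff r c).1 hx
    exact (π.mem_young_iff r c).2 ⟨h1.1, h1.2.1, (h _).trans h1.2.2⟩

lemma le_refl' (π : NCMatching n) : π ≤ π := le_iff_lefts.2 fun _ => le_rfl

lemma le_trans' {ρ σ π : NCMatching n} (h1 : ρ ≤ σ) (h2 : σ ≤ π) : ρ ≤ π :=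
  le_iff_lefts.2 fun d => (le_iff_lefts.1 h2 d).trans (le_iff_lefts.1 h1 d)

lemma le_antisymm' {σ π : NCMatching n} (h1 : σ ≤ π) (h2 : π ≤ σ) : σ = π :=
  young_injective (le_antisymm (h1 : σ.young ≤ π.young) h2)

lemma card_le_of_le {σ π : NCMatching n} (h : σ ≤ π) : σ.young.card ≤ π.young.card :=
  Finset.card_le_card h

end NCMatching

open NCMatching

/-! ### Addable and removable boxes -/

section Arrows

variable {n : ℕ}

/-- Adding a box on the diagonal `j` lowers the path on this diagonal and nowhere else. -/
lemma Arrow.lefts {j : ℕ} {σ π : NCMatching n} (h : Arrow j σ π) (d : ℕ) :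
    σ.lefts d = π.lefts d + if d = j then 1 else 0 := by
  obtain ⟨h1, h2, ⟨r, c⟩, hx, hc, hj⟩ := h
  have hsub : ∀ d, π.lefts d ≤ σ.lefts d := fun d =>
    lefts_le_of_diagonal d fun a b _ _ hab => hc ▸ Finset.mem_insert_of_mem hab
  have heq : ∀ d, d ≠ j → σ.lefts d = π.lefts d := by
    intro d hd
    refine le_antisymm (lefts_le_of_diagonal d fun a b _ hab hm => ?_) (hsub d)
    rw [hc, Finset.mem_insert] at hm
    rcases hm with hm | hm
    · refine absurd ?_ hd
      rw [← hj, ← hm, ← hab]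
      rfl
    · exact hm
  split_ifs with hd
  · subst hd
    have hm : (r, c) ∈ π.young.cells := by
      rw [hc]
      exact Finset.mem_insert_self _ _
    rw [mem_young_iff] at hx hm
    have hj' : n + c - r = d := hj
    rw [hj'] at hx hm
    have h3 := π.lefts_mono (Nat.sub_le d 1)
    have h4 := σ.lefts_add_le (d - 1) 1
    rw [heq (d - 1) (by omega), show d - 1 + 1 = d by omega] at h4
    have : ¬ σ.lefts d ≤ n - 1 - r := fun h => hx ⟨hm.1, hm.2.1, h⟩
    omega
  · rw [add_zero, heq d hd]

lemma Arrow.le {j : ℕ} {σ π : NCMatching n} (h : Arrow j σ π) : σ ≤ π :=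
  le_iff_lefts.2 fun d => by rw [h.lefts d]; omega

lemma Arrow.not_le {j : ℕ} {σ π : NCMatching n} (h : Arrow j σ π) : ¬ π ≤ σ := by
  intro h1
  have h2 := le_iff_lefts.1 h1 j
  rw [h.lefts j, if_pos rfl] at h2
  omega

/-- Adding boxes on the same diagonal to two comparable diagrams keeps them comparable. -/
lemma Arrow.le_of_le {j : ℕ} {σ π σ' π' : NCMatching n} (h : Arrow j σ π) (h' : Arrow j σ' π')
    (hle : σ ≤ σ') : π ≤ π' :=
  le_iff_lefts.2 fun d => by
    have h1 := le_iff_lefts.1 hle d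
    rw [h.lefts d, h'.lefts d] at h1
    omega

/-- Removing boxes on the same diagonal from two comparable diagrams keeps them comparable. -/
lemma Arrow.le_of_le' {j : ℕ} {σ π σ' π' : NCMatching n} (h : Arrow j σ π) (h' : Arrow j σ' π')
    (hle : π ≤ π') : σ ≤ σ' :=
  le_iff_lefts.2 fun d => by
    have h1 := le_iff_lefts.1 hle d
    rw [h.lefts d, h'.lefts d]
    omega

/-- A left-endpoint that is followed by a right-endpoint is joined to it. -/
lemma partner_eq_of_peak (π : NCMatching n) (p r : Fin (2 * n)) (hpr : r.val = p.val + 1)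
    (hp : p < π.partner p) (hr : ¬ r < π.partner r) : π.partner p = r := by
  have h1 := (π.right_iff r).2 hr
  have h2 := π.noncrossing (π.partner r) p
  rw [π.partner_partner] at h2
  have h3 := π.partner_partner r
  by_contra hne
  have h4 : π.partner r ≠ p := by
    rintro h
    rw [h] at h3
    exact hne h3
  refine h2 ⟨?_, ?_, ?_⟩ <;> simp only [Fin.lt_def, Fin.ext_iff, Ne] at * <;> omega

lemma readingWord_insert {μ ν : YoungDiagram} {r c : ℕ} (h : μ.cells = insert (r, c) ν.cells)
    (hν : (r, c) ∉ ν.cells) (h1 : (r + 1, 0) ∉ μ.cells) (h2 : (r, c + 1) ∉ μ.cells) :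
    readingWord n μ = readingWord n ν ++ [diagonal n (r, c)] := by
  have hmem : ∀ a b, (a, b) ∈ μ ↔ (a, b) = (r, c) ∨ (a, b) ∈ ν := by
    intro a b
    rw [← YoungDiagram.mem_cells, h, Finset.mem_insert, YoungDiagram.mem_cells]
  have hrc : (r, c) ∈ μ := (hmem r c).2 (Or.inl rfl)
  rw [YoungDiagram.mem_cells] at hν h1 h2
  have hrow : ∀ s, s ≠ r → μ.rowLen s = ν.rowLen s := by
    intro s hs
    have key : ∀ b, b < μ.rowLen s ↔ b < ν.rowLen s := by
      intro b
      rw [← YoungDiagram.mem_iff_lt_rowLen, ← YoungDiagram.mem_iff_lt_rowLen, hmem, Prod.mk_inj]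
      simp [hs]
    have k1 := key (μ.rowLen s)
    have k2 := key (ν.rowLen s)
    omega
  have hμr : μ.rowLen r = c + 1 := by
    rw [YoungDiagram.mem_iff_lt_rowLen] at hrc h2
    omega
  have hνr : ν.rowLen r = c := by
    rw [YoungDiagram.mem_iff_lt_rowLen] at hν
    by_contra hne
    have h3 : (r, ν.rowLen r) ∈ μ := YoungDiagram.mem_iff_lt_rowLen.2 (by omega)
    rw [hmem, Prod.mk_inj, YoungDiagram.mem_iff_lt_rowLen] at h3
    omega
  have hμc : μ.colLen 0 = r + 1 := by
    have h3 : (r, 0) ∈ μ := YoungDiagram.mem_iff_lt_rowLen.2 (by omega)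
    rw [YoungDiagram.mem_iff_lt_colLen] at h3 h1
    omega
  have hνc : ν.colLen 0 = r + 1 ∨ ν.colLen 0 = r ∧ c = 0 := by
    have h3 : ¬ r + 1 < ν.colLen 0 := by
      rw [← YoungDiagram.mem_iff_lt_colLen]
      exact fun h => h1 ((hmem _ _).2 (Or.inr h))
    have h4 : r < ν.colLen 0 ∨ c = 0 := by
      rw [← YoungDiagram.mem_iff_lt_colLen, YoungDiagram.mem_iff_lt_rowLen]
      omega
    have h5 : ∀ s, s < r → s < ν.colLen 0 := by
      intro s hs
      have h6 : (s, 0) ∈ μ := YoungDiagram.mem_iff_lt_colLen.2 (by omega)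
      rw [hmem, Prod.mk_inj] at h6
      exact YoungDiagram.mem_iff_lt_colLen.1 (h6.resolve_left (by omega))
    have h7 := h5 (r - 1)
    omega
  -- the row number `r` may be missing in `ν`, but then it contributes nothing
  have hνw : readingWord n ν = (List.range (r + 1)).flatMap fun s =>
      (List.range (ν.rowLen s)).map fun c => diagonal n (s, c) := by
    rcases hνc with h3 | ⟨h3, h4⟩
    · rw [readingWord, h3]
    · rw [readingWord, h3, List.range_succ, List.flatMap_append]
      simp [hνr, h4]
  rw [hνw, readingWord, hμc, List.range_succ, List.flatMap_append, List.flatMap_append,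
    List.append_assoc]
  congr 1
  · apply List.flatMap_congr
    intro s hs
    rw [hrow s (List.mem_range.1 hs).ne]
  · simp [hμr, hνr, List.range_succ]

variable [NeZero n]

/-- Adding a box on the diagonal `j` exchanges a left-endpoint at `j` with a right-endpoint at
`j + 1`. -/
lemma Arrow.left_iff {j : ℕ} {σ π : NCMatching n} (h : Arrow j σ π) :
    (pt n j < σ.partner (pt n j) ∧ ¬ pt n j < π.partner (pt n j)) ∧
    (¬ pt n (j + 1) < σ.partner (pt n (j + 1)) ∧ pt n (j + 1) < π.partner (pt n (j + 1))) ∧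
    ∀ i, i ≠ pt n j → i ≠ pt n (j + 1) → (i < σ.partner i ↔ i < π.partner i) := by
  have hj := h.1
  have hj' := h.2.1
  have v1 := pt_val n j (by omega) (by omega)
  have v2 := pt_val n (j + 1) (by omega) (by omega)
  have key : ∀ i : Fin (2 * n), (if i < σ.partner i then 1 else 0) +
      (if i.val = j then 1 else 0) = (if i < π.partner i then 1 else 0) +
      (if i.val + 1 = j then 1 else 0) := by
    intro i
    have e1 := σ.lefts_succ i
    have e2 := π.lefts_succ i
    rw [h.lefts, h.lefts] at e1
    omega
  refine ⟨?_, ?_, ?_⟩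
  · have := key (pt n j)
    rw [if_neg (show ¬ (pt n j).val = j by omega),
      if_pos (show (pt n j).val + 1 = j by omega)] at this
    split_ifs at this <;> simp_all
  · have := key (pt n (j + 1))
    rw [if_pos (show (pt n (j + 1)).val = j by omega),
      if_neg (show ¬ (pt n (j + 1)).val + 1 = j by omega)] at this
    split_ifs at this <;> simp_all
  · intro i h1 h2
    have := key i
    rw [Ne, Fin.ext_iff] at h1 h2
    rw [if_neg (show ¬ i.val = j by omega), if_neg (show ¬ i.val + 1 = j by omega)] at this
    split_ifs at this with c1 c2 c2 <;> omega

/-- The points of the matchings that are related by an arrow differ by a transposition. -/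
lemma Arrow.point {j : ℕ} {σ π : NCMatching n} (h : Arrow j σ π) :
    π.point ∘ Equiv.swap (pt n j) (pt n (j + 1)) = σ.point := by
  obtain ⟨h1, h2, h3⟩ := h.left_iff
  funext i
  rw [Function.comp_apply]
  by_cases c1 : i = pt n j
  · rw [c1, Equiv.swap_apply_left, point_left h2.2, point_left h1.1]
  by_cases c2 : i = pt n (j + 1)
  · rw [c2, Equiv.swap_apply_right, point_right h1.2, point_right h2.1]
  · rw [Equiv.swap_apply_of_ne_of_ne c1 c2]
    by_cases c : i < σ.partner i
    · rw [point_left c, point_left ((h3 i c1 c2).1 c)]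
    · rw [point_right c, point_right (fun h => c ((h3 i c1 c2).2 h))]

lemma pt_val_succ (i : Fin (2 * n)) : pt n (i.val + 1) = i :=
  Fin.ext (by rw [pt_val] <;> omega)

lemma tl_partner {j : ℕ} {p r : Fin (2 * n)} (hp : pt n j = p) (hr : pt n (j + 1) = r)
    (π : NCMatching n) (k : Fin (2 * n)) : (tl j π).partner k =
      if k = p then r else if k = r then p
        else if k = π.partner p then π.partner r else if k = π.partner r then π.partner p
        else π.partner k := by
  simp only [tl, hp, hr]

/-- A right-endpoint that is followed by a left-endpoint is the corner of a removable box. -/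
lemma exists_arrow_of_valley (π : NCMatching n) (p r : Fin (2 * n)) (hpr : r.val = p.val + 1)
    (hp : ¬ p < π.partner p) (hr : r < π.partner r) : ∃ σ, Arrow r.val σ π := by
  refine ⟨tl r.val π, ?_⟩
  have hs := tl_partner (j := r.val) (p := p) (r := r) (by rw [hpr, pt_val_succ])
    (pt_val_succ r) π
  have hp' := (π.right_iff p).2 hp
  have hlt : p < r := by rw [Fin.lt_def]; omega
  have sp := hs p
  have sr := hs r
  have tp := π.partner_partner p
  have tr := π.partner_partner r
  refine young_of_swap p r hpr ?_ ?_ hp' hr ?_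
  · grind
  · grind
  · intro k k1 k2
    have := hs k
    grind

/-- If the points `j` and `j + 1` are both left-endpoints, a box can be added at the next
right-endpoint. -/
lemma exists_arrow_of_left_left (τ : NCMatching n) (p r : Fin (2 * n)) (hpr : r.val = p.val + 1)
    (hp : p < τ.partner p) (hr : r < τ.partner r) : ∃ k τ', Arrow k τ τ' ∧
      ((k = r.val + 1 ∧ p < τ'.partner p ∧ ¬ r < τ'.partner r) ∨
        (r.val + 2 ≤ k ∧ p < τ'.partner p ∧ r < τ'.partner r)) := by
  obtain ⟨u, hu, hmin⟩ := Finset.exists_min_image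
    (Finset.univ.filter (fun u => r < u ∧ ¬ u < τ.partner u)) id
    ⟨τ.partner r, by simp [hr, τ.partner_partner, hr.le]⟩
  simp only [Finset.mem_filter, Finset.mem_univ, true_and, id] at hu hmin
  have hru := Fin.lt_def.1 hu.1
  have hu2 := u.2
  obtain ⟨p1, hp1⟩ : ∃ p1 : Fin (2 * n), u.val = p1.val + 1 := ⟨⟨u.val - 1, by omega⟩, by
    simp only; omega⟩
  obtain ⟨p0, hp0⟩ : ∃ p0 : Fin (2 * n), p1.val = p0.val + 1 := ⟨⟨p1.val - 1, by omega⟩, by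
    simp only; omega⟩
  have hL : ∀ x : Fin (2 * n), p.val ≤ x.val → x.val < u.val → x < τ.partner x := by
    intro x h1 h2
    by_cases c1 : x = p
    · rw [c1]; exact hp
    by_cases c2 : x = r
    · rw [c2]; exact hr
    by_contra hx
    rw [Fin.ext_iff] at c1 c2
    have := hmin x ⟨by rw [Fin.lt_def]; omega, hx⟩
    rw [Fin.le_def] at this
    omega
  have l1 := hL p1 (by omega) (by omega)
  have l0 := hL p0 (by omega) (by omega)
  have hpk := partner_eq_of_peak τ p1 u hp1 l1 hu.2
  have hs := tl_partner (j := p1.val) (p := p0) (r := p1) (by rw [hp0, pt_val_succ])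
    (pt_val_succ p1) τ
  have lt01 : p0 < p1 := by rw [Fin.lt_def]; omega
  have lt1u : p1 < u := by rw [Fin.lt_def]; omega
  have tp := τ.partner_partner p0
  have tr := τ.partner_partner p1
  have hgt : u < τ.partner p0 := by
    have n1 : τ.partner p0 ≠ p1 := by
      intro h
      rw [h, hpk] at tp
      exact absurd tp (lt01.trans lt1u).ne'
    have n2 : τ.partner p0 ≠ u := by
      intro h
      rw [hpk, ← h, tp] at tr
      exact absurd tr lt01.ne
    simp only [Fin.lt_def, Fin.ext_iff, Ne] at *
    omega
  have hw : ∀ k, k ≠ p1 → k ≠ u →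
      (k < τ.partner k ↔ k < (tl p1.val τ).partner k) := by
    intro k k1 k2
    have := hs k
    grind
  refine ⟨u.val, tl p1.val τ, ?_, ?_⟩
  · have s1 := hs p1
    have su := hs u
    refine young_of_swap p1 u hp1 l1 ((τ.right_iff u).2 hu.2) ?_ ?_ hw
    · grind
    · grind
  · have hp' : p < (tl p1.val τ).partner p := by
      refine (hw p ?_ ?_).1 hp <;> rw [Ne, Fin.ext_iff] <;> omega
    by_cases c : u.val = r.val + 1
    · left
      have : r = p1 := Fin.ext (by omega)
      refine ⟨c, hp', ?_⟩
      have s1 := hs p1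
      rw [this]
      grind
    · right
      refine ⟨by omega, hp', ?_⟩
      refine (hw r ?_ ?_).1 hr <;> rw [Ne, Fin.ext_iff] <;> omega

/-- If the points `j` and `j + 1` are both right-endpoints, a box can be added at the previous
left-endpoint. -/
lemma exists_arrow_of_right_right (τ : NCMatching n) (p r : Fin (2 * n)) (hpr : r.val = p.val + 1)
    (hp : ¬ p < τ.partner p) (hr : ¬ r < τ.partner r) : ∃ k τ', Arrow k τ τ' ∧
      ((k = p.val ∧ p < τ'.partner p ∧ ¬ r < τ'.partner r) ∨
        (k + 1 ≤ p.val ∧ ¬ p < τ'.partner p ∧ ¬ r < τ'.partner r)) := by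
  obtain ⟨u, hu, hmax⟩ := Finset.exists_max_image
    (Finset.univ.filter (fun u => u < p ∧ u < τ.partner u)) id
    ⟨τ.partner p, by simp [τ.partner_partner, (τ.right_iff p).2 hp]⟩
  simp only [Finset.mem_filter, Finset.mem_univ, true_and, id] at hu hmax
  have hup := Fin.lt_def.1 hu.1
  have hr2 := r.2
  obtain ⟨p1, hp1⟩ : ∃ p1 : Fin (2 * n), p1.val = u.val + 1 := ⟨⟨u.val + 1, by omega⟩, rfl⟩
  obtain ⟨p2, hp2⟩ : ∃ p2 : Fin (2 * n), p2.val = p1.val + 1 := ⟨⟨p1.val + 1, by omega⟩, rfl⟩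
  have hR : ∀ x : Fin (2 * n), u.val < x.val → x.val ≤ r.val → ¬ x < τ.partner x := by
    intro x h1 h2
    by_cases c1 : x = p
    · rw [c1]; exact hp
    by_cases c2 : x = r
    · rw [c2]; exact hr
    intro hx
    rw [Fin.ext_iff] at c1 c2
    have := hmax x ⟨by rw [Fin.lt_def]; omega, hx⟩
    rw [Fin.le_def] at this
    omega
  have l1 := hR p1 (by omega) (by omega)
  have l2 := hR p2 (by omega) (by omega)
  have hpk := partner_eq_of_peak τ u p1 hp1 hu.2 l1
  have hs := tl_partner (j := p2.val) (p := p1) (r := p2) (by rw [hp2, pt_val_succ])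
    (pt_val_succ p2) τ
  have ltu1 : u < p1 := by rw [Fin.lt_def]; omega
  have lt12 : p1 < p2 := by rw [Fin.lt_def]; omega
  have tu := τ.partner_partner u
  have t2 := τ.partner_partner p2
  have r2 := (τ.right_iff p2).2 l2
  rw [hpk] at tu
  have hlt : τ.partner p2 < u := by
    have n1 : τ.partner p2 ≠ p1 := by
      intro h
      rw [h, tu] at t2
      exact absurd t2 (ltu1.trans lt12).ne
    have n2 : τ.partner p2 ≠ u := by
      intro h
      rw [h, hpk] at t2
      exact absurd t2 lt12.ne
    simp only [Fin.lt_def, Fin.ext_iff, Ne] at *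
    omega
  have hw : ∀ k, k ≠ u → k ≠ p1 →
      (k < τ.partner k ↔ k < (tl p2.val τ).partner k) := by
    intro k k1 k2
    have := hs k
    grind
  refine ⟨p1.val, tl p2.val τ, ?_, ?_⟩
  · have s1 := hs p1
    have su := hs u
    refine young_of_swap u p1 hp1 hu.2 ((τ.right_iff p1).2 l1) ?_ ?_ hw
    · grind
    · grind
  · have hr' : ¬ r < (tl p2.val τ).partner r := by
      refine fun h => hr ((hw r ?_ ?_).2 h) <;> rw [Ne, Fin.ext_iff] <;> omega
    by_cases c : p1 = p
    · left
      have s1 := hs p1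
      refine ⟨by rw [c], ?_, hr'⟩
      rw [← c]
      grind
    · right
      have c' := Fin.val_ne_of_ne c
      refine ⟨by omega, fun h => hp ((hw p ?_ ?_).2 h), hr'⟩ <;> rw [Ne, Fin.ext_iff] <;> omega

/-- A corner box of the Young diagram can be removed. -/
lemma exists_arrow_of_corner (π : NCMatching n) {r c : ℕ} (h : (r, c) ∈ π.young.cells)
    (h1 : (r + 1, c) ∉ π.young.cells) (h2 : (r, c + 1) ∉ π.young.cells) :
    ∃ σ, Arrow (diagonal n (r, c)) σ π ∧ (r, c) ∉ σ.young.cells ∧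
      π.young.cells = insert (r, c) σ.young.cells := by
  rw [mem_young_iff] at h h1 h2
  obtain ⟨hr, hc, h⟩ := h
  obtain ⟨d, hd⟩ : ∃ d, n + c - r = d := ⟨_, rfl⟩
  rw [show n + c - (r + 1) = d - 1 by omega] at h1
  rw [show n + (c + 1) - r = d + 1 by omega] at h2
  rw [hd] at h
  have hb := π.le_two_mul_lefts (d := d) (by omega)
  have e1 := π.lefts_succ ⟨d, by omega⟩
  have e2 := π.lefts_succ ⟨d - 1, by omega⟩
  simp only at e1 e2
  rw [show d - 1 + 1 = d by omega] at e2
  have a1 : ¬ π.lefts (d - 1) ≤ n - 1 - (r + 1) := fun h => h1 ⟨by omega, hc, h⟩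
  have a2 : ¬ π.lefts (d + 1) ≤ n - 1 - r := fun h => h2 ⟨hr, by omega, h⟩
  obtain ⟨σ, hσ⟩ := exists_arrow_of_valley π ⟨d - 1, by omega⟩ ⟨d, by omega⟩ (by simp only; omega)
    (by
      intro h
      rw [if_pos h] at e2
      omega)
    (by
      by_contra h
      rw [if_neg h] at e1
      omega)
  have hσ' : Arrow d σ π := hσ
  have hnot : (r, c) ∉ σ.young.cells := by
    rw [mem_young_iff, hd, hσ'.lefts, if_pos rfl]
    omega
  refine ⟨σ, ?_, hnot, ?_⟩
  · rw [diagonal, hd]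
    exact hσ
  · obtain ⟨-, -, x, hx, hx', -⟩ := hσ'
    have : (r, c) ∈ π.young.cells := (π.mem_young_iff r c).2 ⟨hr, hc, by rw [hd]; exact h⟩
    rw [hx', Finset.mem_insert] at this
    rw [hx', this.resolve_right hnot]

/-- The last box of the reading word can be removed. -/
lemma exists_arrow_readingWord (π : NCMatching n) (hπ : π ≠ nested n) :
    ∃ k σ, Arrow k σ π ∧ readingWord n π.young = readingWord n σ.young ++ [k] := by
  obtain ⟨⟨j, ρ⟩, hρ⟩ := exists_arrow π hπ
  obtain ⟨-, -, ⟨a, b⟩, -, hx, -⟩ := hρ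
  have hab : (a, b) ∈ π.young := by
    rw [← YoungDiagram.mem_cells, hx]
    exact Finset.mem_insert_self _ _
  have ha0 : (a, 0) ∈ π.young := π.young.up_left_mem le_rfl (Nat.zero_le _) hab
  have hcol := YoungDiagram.mem_iff_lt_colLen.1 ha0
  obtain ⟨r, hr⟩ : ∃ r, π.young.colLen 0 = r + 1 := ⟨π.young.colLen 0 - 1, by omega⟩
  have hr0 : (r, 0) ∈ π.young := YoungDiagram.mem_iff_lt_colLen.2 (by omega)
  have hrow := YoungDiagram.mem_iff_lt_rowLen.1 hr0
  obtain ⟨c, hc⟩ : ∃ c, π.young.rowLen r = c + 1 := ⟨π.young.rowLen r - 1, by omega⟩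
  have m1 : (r, c) ∈ π.young.cells :=
    (YoungDiagram.mem_cells _).2 (YoungDiagram.mem_iff_lt_rowLen.2 (by omega))
  have m2 : (r, c + 1) ∉ π.young.cells := by
    rw [YoungDiagram.mem_cells, YoungDiagram.mem_iff_lt_rowLen]
    omega
  have m3 : (r + 1, 0) ∉ π.young.cells := by
    rw [YoungDiagram.mem_cells, YoungDiagram.mem_iff_lt_colLen]
    omega
  obtain ⟨σ, h1, h2, h3⟩ := exists_arrow_of_corner π m1
    (fun h => m3 ((YoungDiagram.mem_cells _).2
      (π.young.up_left_mem le_rfl (Nat.zero_le _) ((YoungDiagram.mem_cells _).1 h)))) m2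
  exact ⟨_, σ, h1, readingWord_insert h3 h2 m3 m2⟩

end Arrows

/-! ### The values at the points of matchings -/

section Values

variable {n : ℕ}

/-- The wheel polynomials that vanish at the points of all the matchings that are not below `π`. -/
def SupportedBelow (π : NCMatching n) (f : Poly n) : Prop :=
  f ∈ W n ∧ ∀ τ : NCMatching n, ¬ τ ≤ π → eval τ.point f = 0

lemma SupportedBelow.mono {σ π : NCMatching n} (h : σ ≤ π) {f : Poly n}
    (hf : SupportedBelow σ f) : SupportedBelow π f :=
  ⟨hf.1, fun τ hτ => hf.2 τ fun h' => hτ (le_trans' h' h)⟩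

/-- The values at the points of the matchings. -/
noncomputable def valueMap : W n →ₗ[K] (NCMatching n → K) where
  toFun f π := eval π.point f.1
  map_add' f g := by
    funext π
    simp
  map_smul' c f := by
    funext π
    simp [smul_eval]

lemma valueMap_injective : Function.Injective (valueMap (n := n)) := by
  rw [← LinearMap.ker_eq_bot, LinearMap.ker_eq_bot']
  intro f hf
  exact Subtype.ext (eq_zero_of_points f.2 fun π => congrFun hf π)

variable [NeZero n]

/-- The operator `𝐃_k - (q + q⁻¹)`. -/
noncomputable def EMap (k : ℕ) : Poly n →ₗ[K] Poly n :=
  tlMap (pt n k) (pt n (k + 1)) (pt_adjacent n k).1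

lemma EMap_apply (k : ℕ) (f : Poly n) : EMap k f = D k f - loop • f := rfl

lemma pt_succ_val {k : ℕ} (h1 : 1 ≤ k) (h2 : k + 1 ≤ 2 * n) :
    (pt n (k + 1)).val = (pt n k).val + 1 := by
  rw [pt_val n k h1 (by omega), pt_val n (k + 1) (by omega) h2]
  omega

lemma D_mem_W {k : ℕ} (h1 : 1 ≤ k) (h2 : k + 1 ≤ 2 * n) {f : Poly n} (hf : f ∈ W n) :
    D k f ∈ W n :=
  divMap_mem_W (pt_succ_val h1 h2) (pt_adjacent n k).1 hf

lemma EMap_mem_W {k : ℕ} (h1 : 1 ≤ k) (h2 : k + 1 ≤ 2 * n) {f : Poly n} (hf : f ∈ W n) :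
    EMap k f ∈ W n :=
  tlMap_mem_W (pt_succ_val h1 h2) (pt_adjacent n k).1 hf

lemma EMap_comm {j k : ℕ} (h1 : 1 ≤ j) (h2 : j + 2 ≤ k) (h3 : k + 1 ≤ 2 * n) (f : Poly n) :
    EMap j (EMap k f) = EMap k (EMap j f) := by
  have v1 := pt_val n j h1 (by omega)
  have v2 := pt_val n (j + 1) (by omega) (by omega)
  have v3 := pt_val n k (by omega) (by omega)
  have v4 := pt_val n (k + 1) (by omega) (by omega)
  refine tlMap_comm _ _ ?_ ?_ ?_ ?_ f <;> rw [Ne, Fin.ext_iff] <;> omega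

lemma EMap_EMap_EMap {k : ℕ} (h1 : 1 ≤ k) (h2 : k + 2 ≤ 2 * n) {f : Poly n} (hf : f ∈ W n) :
    EMap k (EMap (k + 1) (EMap k f)) = EMap k f ∧
      EMap (k + 1) (EMap k (EMap (k + 1) f)) = EMap (k + 1) f :=
  tlMap_tlMap_tlMap (pt_succ_val h1 (by omega)) (pt_succ_val (k := k + 1) (by omega) h2) _ _ hf

/-- The value vanishes for an arch from `k` to `k + 1`. -/
lemma eval_D_peak {k : ℕ} {τ : NCMatching n} (hl : pt n k < τ.partner (pt n k))
    (hr : ¬ pt n (k + 1) < τ.partner (pt n (k + 1))) (f : Poly n) :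
    eval τ.point (D k f) = 0 := by
  refine eval_divOp_eq_zero ?_ f
  rw [point_left hl, point_right hr, mul_inv_cancel₀ q_ne_zero, inv_mul_cancel₀ q_ne_zero]

lemma eval_EMap_peak {k : ℕ} {τ : NCMatching n} (hl : pt n k < τ.partner (pt n k))
    (hr : ¬ pt n (k + 1) < τ.partner (pt n (k + 1))) (f : Poly n) :
    eval τ.point (EMap k f) = -loop * eval τ.point f := by
  rw [EMap_apply, map_sub, eval_D_peak hl hr, smul_eval]
  ring

lemma eval_D_valley {k : ℕ} {σ τ : NCMatching n} (h : Arrow k σ τ) (f : Poly n) :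
    eval τ.point (D k f) = loop * (eval τ.point f - eval σ.point f) := by
  have hq := q_ne_zero
  have hq' := q_sub_inv_ne_zero
  obtain ⟨h1, h2, -⟩ := h.left_iff
  have e1 : τ.point (pt n k) = q := point_right h1.2
  have e2 : τ.point (pt n (k + 1)) = q⁻¹ := point_left h2.2
  have hne : τ.point (pt n k) ≠ τ.point (pt n (k + 1)) := by
    rw [e1, e2]
    exact sub_ne_zero.1 hq'
  have e3 : eval τ.point (D k f) = _ := eval_divOp hne f
  rw [e3, h.point, e1, e2]
  have e4 : (q * q - q⁻¹ * q⁻¹) / (q⁻¹ - q) = -loop := by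
    rw [div_eq_iff (by rw [← neg_sub]; exact neg_ne_zero.2 hq'), loop]
    ring
  rw [e4]
  ring

lemma eval_EMap_valley {k : ℕ} {σ τ : NCMatching n} (h : Arrow k σ τ) (f : Poly n) :
    eval τ.point (EMap k f) = -loop * eval σ.point f := by
  rw [EMap_apply, map_sub, eval_D_valley h, smul_eval]
  ring

/-- If `j` and `j + 1` are both left-endpoints or both right-endpoints of `τ`, then the value of
`𝐃_j f` at the point of `τ` depends only on the values of `f` at the points of larger matchings. A
box can be added to `τ` on some diagonal `k`, so that the value at `τ` is a multiple of the value of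
`E_k f` at a larger matching; the Temperley-Lieb relations allow to move `E_j` past `E_k`. -/
lemma eval_EMap_level {τ : NCMatching n} {j : ℕ} (h1 : 1 ≤ j) (h2 : j + 1 ≤ 2 * n)
    (hlev : pt n j < τ.partner (pt n j) ↔ pt n (j + 1) < τ.partner (pt n (j + 1)))
    {f : Poly n} (hf : f ∈ W n) (hv : ∀ ρ : NCMatching n, τ ≤ ρ → eval ρ.point f = 0) :
    eval τ.point (EMap j f) = 0 := by
  have hloop := neg_ne_zero.2 loop_ne_zero
  have hbound : ∀ ρ : NCMatching n, ρ.young.card ≤ ∑ ρ : NCMatching n, ρ.young.card :=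
    fun ρ => Finset.single_le_sum (f := fun ρ : NCMatching n => ρ.young.card)
      (fun _ _ => Nat.zero_le _) (Finset.mem_univ ρ)
  generalize (∑ ρ : NCMatching n, ρ.young.card) = B at hbound
  obtain ⟨m, hm⟩ : ∃ m, B - τ.young.card = m := ⟨_, rfl⟩
  induction m using Nat.strong_induction_on generalizing τ j f with
  | _ m ih =>
    have v1 := pt_val n j h1 (by omega)
    have v2 := pt_val n (j + 1) (by omega) h2
    have hp1 : (pt n (j + 1)).val = (pt n j).val + 1 := by omega
    obtain ⟨k, τ', hk, hcase⟩ : ∃ k τ', Arrow k τ τ' ∧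
        (((k = j + 1 ∨ k + 1 = j) ∧ pt n j < τ'.partner (pt n j) ∧
          ¬ pt n (j + 1) < τ'.partner (pt n (j + 1))) ∨ ((j + 2 ≤ k ∨ k + 2 ≤ j) ∧
          (pt n j < τ'.partner (pt n j) ↔ pt n (j + 1) < τ'.partner (pt n (j + 1))))) := by
      by_cases hl : pt n j < τ.partner (pt n j)
      · obtain ⟨k, τ', hk, h | h⟩ := exists_arrow_of_left_left τ _ _ hp1 hl (hlev.1 hl)
        · exact ⟨k, τ', hk, Or.inl ⟨Or.inl (by omega), h.2⟩⟩
        · exact ⟨k, τ', hk, Or.inr ⟨Or.inl (by omega), iff_of_true h.2.1 h.2.2⟩⟩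
      · obtain ⟨k, τ', hk, h | h⟩ := exists_arrow_of_right_right τ _ _ hp1 hl
          (fun h => hl (hlev.2 h))
        · exact ⟨k, τ', hk, Or.inl ⟨Or.inr (by omega), h.2⟩⟩
        · exact ⟨k, τ', hk, Or.inr ⟨Or.inr (by omega), iff_of_false h.2.1 h.2.2⟩⟩
    have hk1 := hk.1
    have hk2 := hk.2.1
    have hEf := EMap_mem_W h1 h2 hf
    have e1 := eval_EMap_valley hk (EMap j f)
    refine (mul_eq_zero.1 (e1.symm.trans ?_)).resolve_left hloop
    rcases hcase with ⟨hkj, hl, hr⟩ | ⟨hkj, hlev'⟩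
    · have htl : EMap j (EMap k (EMap j f)) = EMap j f := by
        rcases hkj with rfl | rfl
        · exact (EMap_EMap_EMap h1 (by omega) hf).1
        · exact (EMap_EMap_EMap (k := k) (by omega) (by omega) hf).2
      have e2 := eval_EMap_peak hl hr (EMap k (EMap j f))
      rw [htl, eval_EMap_peak hl hr, hv τ' hk.le, mul_zero] at e2
      exact (mul_eq_zero.1 e2.symm).resolve_left hloop
    · have hcomm : EMap k (EMap j f) = EMap j (EMap k f) := by
        rcases hkj with h | h
        · exact (EMap_comm h1 h (by omega) f).symm
        · exact EMap_comm (by omega) h h2 f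
      rw [hcomm]
      have hlt := hk.card_lt
      refine ih _ ?_ h1 h2 hlev' (EMap_mem_W (by omega) (by omega) hf) ?_ rfl
      · have := hbound τ'
        omega
      · intro ρ hρ
        have hτρ := le_trans' hk.le hρ
        by_cases c1 : pt n k < ρ.partner (pt n k) ↔ pt n (k + 1) < ρ.partner (pt n (k + 1))
        · have := card_le_of_le hρ
          have := hbound ρ
          exact ih _ (by omega) (by omega) (by omega) c1 hf
            (fun ρ' h => hv ρ' (le_trans' hτρ h)) rfl
        · by_cases c2 : pt n k < ρ.partner (pt n k)
          · rw [eval_EMap_peak c2 (fun h => c1 (iff_of_true c2 h)), hv ρ hτρ, mul_zero]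
          · have c3 : pt n (k + 1) < ρ.partner (pt n (k + 1)) := by
              by_contra h
              exact c1 (iff_of_false c2 h)
            obtain ⟨ρ', hρ'⟩ := exists_arrow_of_valley ρ _ _
              (pt_succ_val (k := k) (by omega) (by omega)) c2 c3
            rw [pt_val n (k + 1) (by omega) (by omega), Nat.add_sub_cancel] at hρ'
            rw [eval_EMap_valley hρ', hv ρ' (hk.le_of_le' hρ' hρ), mul_zero]

/-! ### Triangularity -/

lemma supportedBelow_nested : SupportedBelow (nested n) (Psi0 n) :=
  ⟨Psi0_mem_W, fun _ hτ => eval_Psi0_eq_zero fun h => hτ (h ▸ le_refl' _)⟩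

lemma SupportedBelow.D {j : ℕ} {σ π : NCMatching n} (h : Arrow j σ π) {f : Poly n}
    (hf : SupportedBelow σ f) : SupportedBelow π (D j f) := by
  have h1 := h.1
  have h2 := h.2.1
  refine ⟨D_mem_W (by omega) (by omega) hf.1, fun τ hτ => ?_⟩
  have hτσ : ¬ τ ≤ σ := fun h' => hτ (le_trans' h' h.le)
  by_cases c1 : pt n j < τ.partner (pt n j) ↔ pt n (j + 1) < τ.partner (pt n (j + 1))
  · have h3 := eval_EMap_level (by omega) (by omega) c1 hf.1 fun ρ hρ =>
      hf.2 ρ fun h' => hτσ (le_trans' hρ h')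
    rw [EMap_apply, map_sub, smul_eval, hf.2 τ hτσ, mul_zero, sub_zero] at h3
    exact h3
  · by_cases c2 : pt n j < τ.partner (pt n j)
    · exact eval_D_peak c2 (fun h => c1 (iff_of_true c2 h)) f
    · have c3 : pt n (j + 1) < τ.partner (pt n (j + 1)) := by
        by_contra h
        exact c1 (iff_of_false c2 h)
      obtain ⟨ρ, hρ⟩ := exists_arrow_of_valley τ _ _
        (pt_succ_val (k := j) (by omega) (by omega)) c2 c3
      rw [pt_val n (j + 1) (by omega) (by omega), Nat.add_sub_cancel] at hρ
      rw [eval_D_valley hρ, hf.2 τ hτσ, hf.2 ρ fun h' => hτ (hρ.le_of_le h h'), sub_zero, mul_zero]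

lemma SupportedBelow.eval_D {j : ℕ} {σ π : NCMatching n} (h : Arrow j σ π) {f : Poly n}
    (hf : SupportedBelow σ f) : eval π.point (WheelPoly.D j f) = -loop * eval σ.point f := by
  rw [eval_D_valley h, hf.2 π h.not_le]
  ring

/-- The value of `D_π`, and of `Ψ_π`, at the point of `π`. -/
noncomputable def leadingValue (π : NCMatching n) : K :=
  (-loop) ^ π.young.card * eval (nested n).point (Psi0 n)

lemma leadingValue_ne_zero (π : NCMatching n) : leadingValue π ≠ 0 :=
  mul_ne_zero (pow_ne_zero _ (neg_ne_zero.2 loop_ne_zero)) eval_nested_Psi0_ne_zero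

lemma leadingValue_arrow {j : ℕ} {σ π : NCMatching n} (h : Arrow j σ π) :
    leadingValue π = -loop * leadingValue σ := by
  have : π.young.card = σ.young.card + 1 := by
    obtain ⟨-, -, x, hx, hx', -⟩ := h
    rw [YoungDiagram.card, YoungDiagram.card, hx', Finset.card_insert_of_notMem hx]
  rw [leadingValue, leadingValue, this]
  ring

lemma young_nested : (nested n).young = ⊥ := by
  apply le_bot_iff.1
  rintro ⟨r, c⟩ hx
  have h1 := ((nested n).mem_young r c).1 hx
  obtain ⟨i, hi⟩ := Finset.card_pos.1 (lt_of_le_of_lt (Nat.zero_le _) h1)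
  simp only [Finset.mem_filter, Finset.mem_univ, true_and] at hi
  have h2 := (nested n).card_rights i.2.le
  have h3 : Finset.univ.filter (fun k : Fin (2 * n) => k.val < i.val ∧ ¬ k < (nested n).partner k) =
      Finset.Ico ⟨n, by have := NeZero.pos n; omega⟩ i := by
    ext k
    simp only [nested, Fin.lt_def, Fin.val_rev, Finset.mem_filter, Finset.mem_univ, true_and,
      Finset.mem_Ico, Fin.le_def]
    omega
  rw [h3, Fin.card_Ico] at h2
  have h4 : (nested n).height i = (nested n).lefts i.val := rfl
  have h5 := hi.1
  simp only [nested, Fin.lt_def, Fin.val_rev] at h5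
  simp only at h2
  omega

lemma leadingValue_nested : leadingValue (nested n) = eval (nested n).point (Psi0 n) := by
  rw [leadingValue, young_nested, YoungDiagram.card, YoungDiagram.cells_bot, Finset.card_empty,
    pow_zero, one_mul]

lemma DPoly_spec (π : NCMatching n) :
    SupportedBelow π (DPoly π) ∧ eval π.point (DPoly π) = leadingValue π := by
  obtain ⟨m, hm⟩ : ∃ m, π.young.card = m := ⟨_, rfl⟩
  induction m using Nat.strong_induction_on generalizing π with
  | _ m ih =>
    by_cases hπ : π = nested n
    · subst hπ
      have h1 : DPoly (nested n) = Psi0 n := by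
        have h2 : (nested n).young.colLen 0 = 0 := by
          by_contra h
          have h3 := YoungDiagram.mem_iff_lt_colLen.2 (Nat.pos_of_ne_zero h)
          rw [young_nested] at h3
          exact YoungDiagram.notMem_bot _ h3
        rw [DPoly, readingWord, h2]
        rfl
      rw [h1, leadingValue_nested]
      exact ⟨supportedBelow_nested, rfl⟩
    · obtain ⟨k, σ, hσ, hword⟩ := exists_arrow_readingWord π hπ
      have h1 : DPoly π = D k (DPoly σ) := by
        rw [DPoly, hword, List.foldl_append]
        rfl
      obtain ⟨h2, h3⟩ := ih _ (hm ▸ hσ.card_lt) σ rfl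
      rw [h1, leadingValue_arrow hσ, ← h3]
      exact ⟨h2.D hσ, h2.eval_D hσ⟩

lemma Psi_spec (s : ArrowChoice n) (π : NCMatching n) :
    SupportedBelow π (Psi s π) ∧ eval π.point (Psi s π) = leadingValue π := by
  obtain ⟨m, hm⟩ : ∃ m, π.young.card = m := ⟨_, rfl⟩
  induction m using Nat.strong_induction_on generalizing π with
  | _ m ih =>
    rw [Psi]
    split_ifs with hπ
    · rw [hπ, leadingValue_nested]
      exact ⟨supportedBelow_nested, rfl⟩
    · obtain ⟨⟨j, σ⟩, hσ⟩ := s π hπ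
      dsimp only at hσ ⊢
      obtain ⟨h1, h2⟩ := ih _ (hm ▸ hσ.card_lt) σ rfl
      have h3 : ∀ τ : {τ : NCMatching n // tl j τ = σ ∧ τ ≠ σ ∧ τ ≠ π},
          SupportedBelow σ (Psi s τ.1) := by
        intro τ
        have h4 := le_of_tl_eq hσ τ.2.1 τ.2.2.2
        exact (ih _ (hm ▸ lt_of_le_of_lt (card_le_of_le h4) hσ.card_lt) τ.1 rfl).1.mono h4
      refine ⟨⟨(W n).sub_mem (h1.D hσ).1 ((W n).sum_mem fun τ _ => (h3 τ).1), ?_⟩, ?_⟩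
      · intro τ hτ
        rw [map_sub, map_sum, (h1.D hσ).2 τ hτ, Finset.sum_eq_zero, sub_zero]
        exact fun ρ _ => ((h3 ρ).mono hσ.le).2 τ hτ
      · rw [map_sub, map_sum, h1.eval_D hσ, h2, Finset.sum_eq_zero, sub_zero, leadingValue_arrow hσ]
        exact fun ρ _ => (h3 ρ).2 π hσ.not_le

/-! ### The basis -/

/-- If a combination of the `D_τ` vanishes at the points of all the matchings that are not below
`π`, then it involves only the `D_τ` with `τ ≤ π`: the matrix of the values is triangular. -/
lemma coeff_eq_zero_of_eval (P : NCMatching n → Prop) (hP : ∀ σ τ, P σ → σ ≤ τ → P τ)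
    (c : NCMatching n → K)
    (h : ∀ τ, P τ → eval τ.point (∑ ρ : NCMatching n, c ρ • DPoly ρ) = 0) :
    ∀ τ, P τ → c τ = 0 := by
  classical
  by_contra hcon
  push Not at hcon
  obtain ⟨τ0, hτ0⟩ := hcon
  -- a matching with the largest possible diagram among those that contribute
  obtain ⟨τ, hτ, hmax⟩ := Finset.exists_max_image
    (Finset.univ.filter fun τ : NCMatching n => P τ ∧ c τ ≠ 0) (fun τ => τ.young.card)
    ⟨τ0, by simpa using hτ0⟩
  simp only [Finset.mem_filter, Finset.mem_univ, true_and] at hτ hmax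
  have h1 := h τ hτ.1
  rw [map_sum, Finset.sum_eq_single τ] at h1
  · rw [smul_eval, (DPoly_spec τ).2] at h1
    exact (mul_ne_zero hτ.2 (leadingValue_ne_zero τ)) h1
  · intro ρ _ hρ
    rw [smul_eval]
    by_cases hle : τ ≤ ρ
    · by_cases hc : c ρ = 0
      · rw [hc, zero_mul]
      · have h2 := hmax ρ ⟨hP τ ρ hτ.1 hle, hc⟩
        have h3 := Finset.eq_of_subset_of_card_le hle h2
        exact absurd (young_injective (YoungDiagram.ext h3)).symm hρ
    · rw [(DPoly_spec ρ).1.2 τ hle, mul_zero]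
  · intro hh
    exact absurd (Finset.mem_univ τ) hh

/-- The polynomial `D_π` as an element of `W_n[z]`. -/
noncomputable def DVec (π : NCMatching n) : W n := ⟨DPoly π, (DPoly_spec π).1.1⟩

lemma linearIndependent_DVec : LinearIndependent K (DVec (n := n)) := by
  rw [Fintype.linearIndependent_iff]
  intro c hc τ
  refine coeff_eq_zero_of_eval (fun _ => True) (fun _ _ _ _ => trivial) c ?_ τ trivial
  intro τ _
  have h1 := congrArg (W n).subtype hc
  rw [map_sum, map_zero] at h1
  have h2 : ∑ ρ : NCMatching n, c ρ • DPoly ρ = 0 := h1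
  rw [h2, map_zero]

lemma exists_basis : ∃ b : Module.Basis (NCMatching n) K (W n),
    ∀ π : NCMatching n, (b π : Poly n) = DPoly π := by
  have hfin : Module.Finite K (W n) := Module.Finite.of_injective _ (valueMap_injective (n := n))
  have h1 : Module.finrank K (W n) ≤ Fintype.card (NCMatching n) := by
    have := LinearMap.finrank_le_finrank_of_injective (valueMap_injective (n := n))
    rwa [Module.finrank_fintype_fun_eq_card] at this
  have h2 := (linearIndependent_DVec (n := n)).fintype_card_le_finrank
  have : Nonempty (NCMatching n) := ⟨nested n⟩
  refine ⟨basisOfLinearIndependentOfCardEqFinrank linearIndependent_DVec (le_antisymm h2 h1), ?_⟩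
  intro π
  rw [coe_basisOfLinearIndependentOfCardEqFinrank]
  rfl

lemma exists_expansion (s : ArrowChoice n) (π : NCMatching n) :
    ∃ c : NCMatching n → K, c π = 1 ∧ (∀ τ : NCMatching n, ¬ τ ≤ π → c τ = 0) ∧
      Psi s π = ∑ τ : NCMatching n, c τ • DPoly τ := by
  obtain ⟨b, hb⟩ := exists_basis (n := n)
  obtain ⟨h1, h2⟩ := Psi_spec s π
  obtain ⟨x, hx⟩ : ∃ x : W n, (x : Poly n) = Psi s π := ⟨⟨_, h1.1⟩, rfl⟩
  have hsum : Psi s π = ∑ τ : NCMatching n, b.repr x τ • DPoly τ := by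
    have h3 := congrArg (W n).subtype (b.sum_repr x)
    rw [map_sum] at h3
    rw [← hx]
    refine h3.symm.trans (Finset.sum_congr rfl fun τ _ => ?_)
    rw [map_smul, ← hb]
    rfl
  generalize (b.repr x : NCMatching n → K) = c at hsum
  have hzero := coeff_eq_zero_of_eval (fun τ => ¬ τ ≤ π)
    (fun σ τ h h' h'' => h (le_trans' h' h'')) c (fun τ hτ => by rw [← hsum]; exact h1.2 τ hτ)
  refine ⟨c, ?_, hzero, hsum⟩
  rw [hsum, map_sum, Finset.sum_eq_single π] at h2
  · rw [smul_eval, (DPoly_spec π).2] at h2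
    exact mul_right_cancel₀ (leadingValue_ne_zero π) (by rw [h2, one_mul])
  · intro τ _ hτ
    rw [smul_eval]
    by_cases hle : τ ≤ π
    · rw [(DPoly_spec τ).1.2 π fun h => hτ (le_antisymm' hle h), mul_zero]
    · rw [hzero τ hle, zero_mul]
  · intro hh
    exact absurd (Finset.mem_univ π) hh

end Values

end WheelPoly

theorem mainTheorem2 (n : ℕ) [NeZero n] :
    (∃ b : Module.Basis (WheelPoly.NCMatching n) WheelPoly.K (WheelPoly.W n),
      ∀ π : WheelPoly.NCMatching n, (b π : WheelPoly.Poly n) = WheelPoly.DPoly π) ∧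
    ∀ (s : WheelPoly.ArrowChoice n) (π : WheelPoly.NCMatching n),
      ∃ c : WheelPoly.NCMatching n → WheelPoly.K,
        c π = 1 ∧ (∀ τ : WheelPoly.NCMatching n, ¬ τ ≤ π → c τ = 0) ∧
          WheelPoly.Psi s π = ∑ τ : WheelPoly.NCMatching n, c τ • WheelPoly.DPoly τ :=
  ⟨WheelPoly.exists_basis, WheelPoly.exists_expansion⟩
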